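/- **Setting.** Let $\Omega\subset\mathbb R^2$ be a bounded Lipschitz domain with polygonal boundary and let $\mathcal T$ be a conforming triangulation of $\Omega$ into finitely many closed triangles $K$ with diameter $h_K$ and inscribed-ball diameter $\rho_K$; $\gamma_{\mathcal T}:=\max_{K\in\mathcal T}h_K/\rho_K$. For a vertex $z\in\mathcal V(\mathcal T)$ let $\mathcal T_z:=\{K\in\mathcal T: z\in K\}=\{K_1,\dots,K_{N_z}\}$ with a fixed counterclockwise numbering (consecutive triangles share an edge that contains $z$; for $z\in\Omega$ the patch closes up), $\omega_z:=\bigcup\mathcal T_z$, and let $\theta_\ell$ be the angle of $K_\ell$ at $z$. Put $\Theta(z):=\max_{1\le i\le N_z}|\sin(\theta_i+\theta_{i+1})|$ (cyclic indices) if $z\in\Omega$; $\Theta(z):=\max_{1\le i\le N_z-1}|\sin(\theta_i+\theta_{i+1})|$ if $z\in\partial\Omega$ and $N_z>1$; $\Theta(z):=0$ if $z\in\partial\Omega$ and $N_z=1$. For $\eta\ge0$ let $$\mathcal C_{\mathcal T}(\eta):=\{z\in\mathcal V(\mathcal T):\Theta(z)\le\eta\},\qquad \mathcal{SC}_{\mathcal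 T}(\eta):=\{z\in\mathcal C_{\mathcal T}(\eta): N_z\in\{1,3\}\}.$$ For $z\in\mathcal{SC}_{\mathcal T}(\eta)$ let $K_z:=K_1$ if $N_z=1$ and $K_z:=K_2$ if $N_z=3$. Assume that for each such $z$ there is a triangle $K_z'\in\mathcal T\setminus\mathcal T_z$ that shares an edge with $K_z$, and put $\mathcal T_z^*:=\mathcal T_z\cup\{K_z'\}$, $\omega_z^*:=\omega_z\cup K_z'$. The vertex $z\in\mathcal{SC}_{\mathcal T}(\eta)$ is a *Robinson vertex* if $\mathcal T_z^*\cap\mathcal T_y^*=\emptyset$ for all $y\in\mathcal{SC}_{\mathcal T}(\eta)\setminus\{z\}$ and $\omega_z^*\cap\mathcal C_{\mathcal T}(\eta)=\{z\}$. Let $\mathbb P_{k-1}(\mathcal T)\subset L^2(\Omega)$ be the space of piecewise polynomials of total degree at most $k-1$ on $\mathcal T$, and $\mathbb P_{k-1,0}(\mathcal T)$ its subspace of functions with vanishing integral. Write $\overline q:=|\Omega|^{-1}\int_\Omega q$, $q_{\mathrm{mvz}}:=q-\overline q$, $A_{\mathcal T,z}(q):=\sum_{\ell=1}^{N_z}(-1)^\ell(q|_{K_\ell})(z)$,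 and let $$b_{k-1,z}:=\sum_{\ell=1}^{N_z}\frac{(-1)^{k-1+\ell}}{|K_\ell|}P^{(0,2)}_{k-1}(1-2\lambda_{K_\ell,z})\,\chi_{K_\ell}$$ with the Jacobi polynomial $P^{(0,2)}_{k-1}$, the barycentric coordinate $\lambda_{K_\ell,z}$ of $K_\ell$ belonging to $z$, and the characteristic function $\chi_{K_\ell}$ of $K_\ell$. Set $$M_{\eta,k-1}(\mathcal T):=\{q\in\mathbb P_{k-1,0}(\mathcal T): A_{\mathcal T,z}(q)=0\ \ \forall z\in\mathcal C_{\mathcal T}(\eta)\}.$$ Given linear functionals $f_z:\mathbb P_{k-1}(\mathcal T)\to\mathbb R$ for $z\in\mathcal{SC}_{\mathcal T}(\eta)$, set $$M^{\mathrm{mod}}_{\eta,k-1}(\mathcal T):=\Big\{q+\sum_{z\in\mathcal{SC}_{\mathcal T}(\eta)}f_z(q)\,(b_{k-1,z})_{\mathrm{mvz}}:\ q\in M_{\eta,k-1}(\mathcal T)\Big\},$$ let $M^{\mathrm{mod}}_{\eta,k-1}(\mathcal T)^\perp:=\{q\in\mathbb P_{k-1,0}(\mathcal T):(q,p)_{L^2(\Omega)}=0\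 \ \forall p\in M^{\mathrm{mod}}_{\eta,k-1}(\mathcal T)\}$, and let $\phi_z\in M_{\eta,k-1}(\mathcal T)$ be the Riesz representative of $f_z|_{M_{\eta,k-1}(\mathcal T)}$, i.e. $(\phi_z,q_0)_{L^2(\Omega)}=f_z(q_0)$ for all $q_0\in M_{\eta,k-1}(\mathcal T)$. **Lemma.** For every $\Omega$ and every $\gamma$ there is $\eta_0>0$, depending only on $\Omega$ and $\gamma$, such that the following holds for every triangulation $\mathcal T$ of $\Omega$ as above with $\gamma_{\mathcal T}\le\gamma$, every $0\le\eta<\eta_0$ and every $k\ge4$. If for every $z\in\mathcal{SC}_{\mathcal T}(\eta)$ a triangle $K_z'$ as above exists and $z$ is a Robinson vertex, then, for all linear functionals $f_z$, the functions $b_{k-1,z}$, $z\in\mathcal C_{\mathcal T}(\eta)\setminus\mathcal{SC}_{\mathcal T}(\eta)$, together with $$\varphi_z:=\phi_z-\frac1{\|b_{k-1,z}\|_{L^2(\Omega)}^2}\Big((b_{k-1,z})_{\mathrm{mvz}}+\sum_{y\in\mathcal{SC}_{\mathcal T}(\eta)}\big(\overline{b_{k-1,z}},b_{k-1,y}\big)_{L^2(\Omega)}\,\phi_y\Big),\qquad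 z\in\mathcal{SC}_{\mathcal T}(\eta),$$ form a basis, indexed by $\mathcal C_{\mathcal T}(\eta)$, of $M^{\mathrm{mod}}_{\eta,k-1}(\mathcal T)^\perp$. -/

import Mathlib

open MeasureTheory

noncomputable section

namespace PressureWired

open scoped Classical Topology

/-- The Euclidean plane. -/
abbrev Plane : Type := EuclideanSpace ℝ (Fin 2)

/-- A (nonempty) bounded Lipschitz domain in the plane with polygonal boundary: the boundary is a
finite union of segments and, near each of its points, the domain is, in suitable Cartesian
coordinates, the region strictly above the graph of a Lipschitz function. -/
structure Domain where
  carrier : Set Plane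
  isOpen : IsOpen carrier
  isConnected : IsConnected carrier
  isBounded : Bornology.IsBounded carrier
  polygonal : ∃ S : Finset (Plane × Plane), frontier carrier = ⋃ s ∈ S, segment ℝ s.1 s.2
  lipschitz : ∀ x ∈ frontier carrier,
    ∃ (e : Plane ≃ᵃⁱ[ℝ] Plane) (g : ℝ → ℝ) (L : NNReal), LipschitzWith L g ∧
      ∃ U ∈ 𝓝 x, ∀ y ∈ U, (y ∈ carrier ↔ g (e y 0) < e y 1)

/-- Lebesgue measure on `Ω`. -/
abbrev Domain.measure (Ω : Domain) : Measure Plane := volume.restrict Ω.carrier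

instance (Ω : Domain) : IsFiniteMeasure Ω.measure :=
  isFiniteMeasure_restrict.2 Ω.isBounded.measure_lt_top.ne

/-- The Hilbert space `L²(Ω)`. -/
abbrev L2 (Ω : Domain) : Type := Lp ℝ 2 Ω.measure

/-- The integral mean of `q` over `Ω`. -/
def mean {Ω : Domain} (q : L2 Ω) : ℝ := ⨍ x in Ω.carrier, q x

/-- The constant function `c` as an element of `L²(Ω)`. -/
def constL2 (Ω : Domain) (c : ℝ) : L2 Ω := Lp.const 2 Ω.measure c

/-- `q_mvz = q - mean q`. -/
def mvz {Ω : Domain} (q : L2 Ω) : L2 Ω := q - constL2 Ω (mean q)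

/-- The closed triangle spanned by a set of three vertices. -/
abbrev hull (K : Finset Plane) : Set Plane := convexHull ℝ (K : Set Plane)

/-- A conforming triangulation of `Ω` into finitely many nondegenerate closed triangles;
a triangle is given by the set of its three vertices. Conformity: two triangles meet in
the convex hull of their common vertices (nothing, a vertex, an edge, or the whole triangle). -/
structure Triangulation (Ω : Domain) where
  triangles : Finset (Finset Plane)
  card_eq : ∀ K ∈ triangles, K.card = 3
  indep : ∀ K ∈ triangles, AffineIndependent ℝ ((↑) : K → Plane)
  conforming : ∀ K ∈ triangles, ∀ K' ∈ triangles, hull K ∩ hull K' = hull (K ∩ K')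
  cover : (⋃ K ∈ triangles, hull K) = closure Ω.carrier

/-- The diameter `ρ_K` of the largest ball inscribed in the triangle. -/
def inDiam (K : Finset Plane) : ℝ :=
  sSup {d : ℝ | ∃ (c : Plane) (r : ℝ), 0 ≤ r ∧ d = 2 * r ∧ Metric.closedBall c r ⊆ hull K}

/-- The two-dimensional cross product. -/
def cross (u v : Plane) : ℝ := u 0 * v 1 - u 1 * v 0

/-- The Jacobi polynomial `P_n^{(α,β)}` for natural parameters `α, β`, i.e.
`∑ₛ C(n+α,n-s) C(n+β,s) ((x-1)/2)^s ((x+1)/2)^{n-s}`. -/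
def jacobi (α β n : ℕ) : Polynomial ℝ :=
  ∑ s ∈ Finset.range (n + 1),
    Polynomial.C (((n + α).choose (n - s) : ℝ) * ((n + β).choose s : ℝ)) *
      (Polynomial.C (1 / 2) * (Polynomial.X - 1)) ^ s *
      (Polynomial.C (1 / 2) * (Polynomial.X + 1)) ^ (n - s)

/-- The barycentric coordinate at `x`, belonging to the vertex `z`, of the triangle with
vertices `z, a, b`. -/
def bary (z a b x : Plane) : ℝ := cross (a - x) (b - x) / cross (a - z) (b - z)

namespace Triangulation

variable {Ω : Domain} (T : Triangulation Ω)

/-- The shape-regularity constant `max_K h_K / ρ_K`. -/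
def shapeRegularity : ℝ := ⨆ K : T.triangles, Metric.diam (hull K.1) / inDiam K.1

/-- The set of vertices. -/
def vertices : Finset Plane := T.triangles.biUnion id

/-- The vertex patch: all triangles of the mesh that contain `z`. -/
def patch (z : Plane) : Finset (Finset Plane) := T.triangles.filter fun K => z ∈ hull K

/-- The number `N_z` of triangles in the patch. -/
def N (z : Plane) : ℕ := (T.patch z).card

/-- A fixed local counterclockwise numbering of the triangles of every vertex patch.
The edges of the patch at `z`, in counterclockwise order, end in `pt z 0, pt z 1, …, pt z N_z`,
and the triangles are `K_{ℓ+1} = conv {z, pt z ℓ, pt z (ℓ+1)}` for `0 ≤ ℓ < N_z`.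
At an interior vertex the patch closes up. -/
structure Numbering where
  pt : Plane → ℕ → Plane
  ccw : ∀ z ∈ T.vertices, ∀ ℓ < T.N z, 0 < cross (pt z ℓ - z) (pt z (ℓ + 1) - z)
  enum : ∀ z ∈ T.vertices,
    (Finset.range (T.N z)).image (fun ℓ => ({z, pt z ℓ, pt z (ℓ + 1)} : Finset Plane)) = T.patch z
  closed : ∀ z ∈ T.vertices, z ∈ Ω.carrier → pt z (T.N z) = pt z 0

/-- `ℙ_n(𝒯)`: the functions in `L²(Ω)` that coincide on the interior of every triangle of the mesh
with a polynomial of total degree at most `n`. -/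
def brokenPoly (n : ℕ) : Submodule ℝ (L2 Ω) where
  carrier := {q | ∀ K ∈ T.triangles, ∃ p : MvPolynomial (Fin 2) ℝ, p.totalDegree ≤ n ∧
    ∀ᵐ x ∂Ω.measure, x ∈ interior (hull K) → q x = MvPolynomial.eval (fun i => x i) p}
  add_mem' := by
    intro q r hq hr K hK
    obtain ⟨p, hp, hp'⟩ := hq K hK
    obtain ⟨s, hs, hs'⟩ := hr K hK
    refine ⟨p + s, (MvPolynomial.totalDegree_add p s).trans (max_le hp hs), ?_⟩
    filter_upwards [hp', hs', Lp.coeFn_add q r] with x h1 h2 h3 hx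
    rw [h3, Pi.add_apply, h1 hx, h2 hx, map_add]
  zero_mem' := by
    intro K _
    refine ⟨0, by simp, ?_⟩
    filter_upwards [Lp.coeFn_zero ℝ 2 Ω.measure] with x h _
    rw [h]; simp
  smul_mem' := by
    intro c q hq K hK
    obtain ⟨p, hp, hp'⟩ := hq K hK
    refine ⟨c • p, (MvPolynomial.totalDegree_smul_le c p).trans hp, ?_⟩
    filter_upwards [hp', Lp.coeFn_smul c q] with x h1 h2 hx
    rw [h2, Pi.smul_apply, h1 hx, MvPolynomial.smul_eval, smul_eq_mul]

/-- The polynomial `q|_K` (it is unique, as the interior of `K` is a nonempty open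
subset of `Ω`). -/
def localPoly {Ω : Domain} (q : L2 Ω) (K : Finset Plane) : MvPolynomial (Fin 2) ℝ :=
  if h : ∃ p : MvPolynomial (Fin 2) ℝ,
      ∀ᵐ x ∂Ω.measure, x ∈ interior (hull K) → q x = MvPolynomial.eval (fun i => x i) p
  then h.choose else 0

namespace Numbering

variable {T} (σ : T.Numbering)

/-- The triangle with number `ℓ + 1` at `z`. -/
def tri (z : Plane) (ℓ : ℕ) : Finset Plane := {z, σ.pt z ℓ, σ.pt z (ℓ + 1)}

/-- The angle at `z` of the triangle with number `ℓ + 1`. -/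
def angle (z : Plane) (ℓ : ℕ) : ℝ := EuclideanGeometry.angle (σ.pt z ℓ) z (σ.pt z (ℓ + 1))

/-- The measure of singularity `Θ(z)`: the maximum of `|sin (θ_i + θ_{i+1})|` over all pairs of
consecutive triangles at `z` (cyclically, if `z` is an interior vertex), and `0` at a boundary
vertex with one triangle. -/
def Theta (z : Plane) : ℝ :=
  if z ∈ Ω.carrier then
    ⨆ i : Fin (T.N z), |Real.sin (σ.angle z i + σ.angle z ((i + 1) % T.N z))|
  else if T.N z = 1 then 0
  else ⨆ i : Fin (T.N z - 1), |Real.sin (σ.angle z i + σ.angle z (i + 1))|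

/-- The set of `η`-critical vertices. -/
def crit (η : ℝ) : Finset Plane := T.vertices.filter fun z => σ.Theta z ≤ η

/-- The set of `η`-super critical vertices. -/
def superCrit (η : ℝ) : Finset Plane := (σ.crit η).filter fun z => T.N z = 1 ∨ T.N z = 3

/-- `A_{𝒯,z}(q) = ∑_ℓ (-1)^ℓ (q|_{K_ℓ})(z)`. -/
def altSum (z : Plane) (q : L2 Ω) : ℝ :=
  ∑ ℓ ∈ Finset.range (T.N z),
    (-1) ^ (ℓ + 1) * MvPolynomial.eval (fun i => z i) (localPoly q (σ.tri z ℓ))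

/-- The critical function `b_{n,z}` as a function on the plane. -/
def critFun (n : ℕ) (z : Plane) (x : Plane) : ℝ :=
  ∑ ℓ ∈ Finset.range (T.N z),
    (hull (σ.tri z ℓ)).indicator (fun y =>
      (-1) ^ (n + (ℓ + 1)) / volume.real (hull (σ.tri z ℓ)) *
        (jacobi 0 2 n).eval (1 - 2 * bary z (σ.pt z ℓ) (σ.pt z (ℓ + 1)) y)) x

theorem memLp_critFun (n : ℕ) (z : Plane) : MemLp (σ.critFun n z) 2 Ω.measure := by
  unfold critFun
  refine memLp_finsetSum _ fun ℓ _ => ?_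
  have hc : IsCompact (hull (σ.tri z ℓ)) := (Finset.finite_toSet _).isCompact_convexHull (𝕜 := ℝ)
  have hcont : Continuous fun y : Plane =>
      (-1 : ℝ) ^ (n + (ℓ + 1)) / volume.real (hull (σ.tri z ℓ)) *
        (jacobi 0 2 n).eval (1 - 2 * bary z (σ.pt z ℓ) (σ.pt z (ℓ + 1)) y) := by
    refine continuous_const.mul ((Polynomial.continuous _).comp ?_)
    unfold bary cross
    simp only [PiLp.sub_apply]
    fun_prop
  obtain ⟨C, hC⟩ := hc.exists_bound_of_continuousOn hcont.continuousOn
  refine MemLp.of_bound (hcont.aestronglyMeasurable.indicator hc.measurableSet) (max C 0)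
    (Filter.Eventually.of_forall fun x => ?_)
  by_cases hx : x ∈ hull (σ.tri z ℓ)
  · rw [Set.indicator_of_mem hx]; exact (hC x hx).trans (le_max_left _ _)
  · rw [Set.indicator_of_notMem hx]; simp

/-- The critical function `b_{n,z}` as an element of `L²(Ω)`. -/
def b (n : ℕ) (z : Plane) : L2 Ω := (σ.memLp_critFun n z).toLp

/-- The reduced pressure space `M_{η,n}(𝒯)`. -/
def pressure (η : ℝ) (n : ℕ) : Set (L2 Ω) :=
  {q | q ∈ T.brokenPoly n ∧ ∫ x in Ω.carrier, q x = 0 ∧ ∀ z ∈ σ.crit η, σ.altSum z q = 0}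

/-- The modified reduced pressure space `M^mod_{η,n}(𝒯)` for functionals `f_z` on `ℙ_n(𝒯)`. -/
def modPressure (η : ℝ) (n : ℕ) (f : Plane → T.brokenPoly n →ₗ[ℝ] ℝ) : Set (L2 Ω) :=
  {p | ∃ q : T.brokenPoly n, (q : L2 Ω) ∈ σ.pressure η n ∧
    p = q + ∑ z ∈ σ.superCrit η, f z q • mvz (σ.b n z)}

/-- The `L²`-orthogonal complement of `M^mod_{η,n}(𝒯)` in `ℙ_{n,0}(𝒯)`. -/
def modPressurePerp (η : ℝ) (n : ℕ) (f : Plane → T.brokenPoly n →ₗ[ℝ] ℝ) :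
    Submodule ℝ (L2 Ω) where
  carrier := {q | q ∈ T.brokenPoly n ∧ ∫ x in Ω.carrier, q x = 0 ∧
    ∀ p ∈ σ.modPressure η n f, inner ℝ q p = 0}
  add_mem' := by
    rintro q r ⟨hq, hq0, hq'⟩ ⟨hr, hr0, hr'⟩
    refine ⟨add_mem hq hr, ?_, fun p hp => by rw [inner_add_left, hq' p hp, hr' p hp, add_zero]⟩
    rw [integral_congr_ae (Lp.coeFn_add q r)]
    simp only [Pi.add_apply]
    rw [integral_add ((Lp.memLp q).integrable (by norm_num))
      ((Lp.memLp r).integrable (by norm_num)), hq0, hr0, add_zero]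
  zero_mem' := by
    refine ⟨zero_mem _, ?_, fun p _ => inner_zero_left p⟩
    rw [integral_congr_ae (Lp.coeFn_zero ℝ 2 Ω.measure)]
    simp
  smul_mem' := by
    rintro c q ⟨hq, hq0, hq'⟩
    refine ⟨Submodule.smul_mem _ c hq, ?_, fun p hp => by
      rw [real_inner_smul_left, hq' p hp, mul_zero]⟩
    rw [integral_congr_ae (Lp.coeFn_smul c q)]
    simp only [Pi.smul_apply]
    rw [integral_smul, hq0, smul_zero]

/-- The triangle `K_z` of a super-critical vertex: `K_1` if `N_z = 1` and `K_2` if `N_z = 3`. -/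
def innerTri (z : Plane) : Finset Plane := if T.N z = 1 then σ.tri z 0 else σ.tri z 1

/-- `K'` is a triangle of the mesh that shares an edge with `K_z` and is not in the patch of `z`. -/
def IsExtension (z : Plane) (K' : Finset Plane) : Prop :=
  K' ∈ T.triangles ∧ (K' ∩ σ.innerTri z).card = 2 ∧ K' ∉ T.patch z

/-- The extended patch `𝒯_z^*`, for a given choice `z ↦ K'_z` of the extension triangles. -/
def extPatch (_σ : T.Numbering) (K' : Plane → Finset Plane) (z : Plane) : Finset (Finset Plane) :=
  insert (K' z) (T.patch z)

/-- `z` is a Robinson vertex. -/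
def IsRobinson (η : ℝ) (K' : Plane → Finset Plane) (z : Plane) : Prop :=
  (∀ y ∈ σ.superCrit η, y ≠ z → σ.extPatch K' z ∩ σ.extPatch K' y = ∅) ∧
  (⋃ K ∈ σ.extPatch K' z, hull K) ∩ (σ.crit η : Set Plane) = {z}

/-- `φ` is the Riesz representative in `M_{η,n}(𝒯)` of the restriction of `f` to `M_{η,n}(𝒯)`. -/
def IsRieszRep (η : ℝ) (n : ℕ) (f : T.brokenPoly n →ₗ[ℝ] ℝ) (φ : L2 Ω) : Prop :=
  φ ∈ σ.pressure η n ∧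
    ∀ q : T.brokenPoly n, (q : L2 Ω) ∈ σ.pressure η n → inner ℝ φ (q : L2 Ω) = f q

/-- The function
`φ_z - ‖b_{n,z}‖⁻² ((b_{n,z})_mvz + ∑_y (mean b_{n,z}, b_{n,y}) φ_y)`. -/
def varphi (η : ℝ) (n : ℕ) (φ : Plane → L2 Ω) (z : Plane) : L2 Ω :=
  φ z - (1 / ‖σ.b n z‖ ^ 2) • (mvz (σ.b n z) +
    ∑ y ∈ σ.superCrit η, (inner ℝ (constL2 Ω (mean (σ.b n z))) (σ.b n y) : ℝ) • φ y)

end Numbering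

end Triangulation

end PressureWired

end

open PressureWired

/-!
The critical function `b_{n,z}`, with `n = k - 1`, represents the functional `A_{𝒯,z}` on `ℙ_n(𝒯)`
up to a positive factor (`inner_b`): on each triangle, in Duffy coordinates centred at `z`, a
polynomial of degree at most `n` is integrated along the rays through `z` against the Jacobi
polynomial `P_n^{(0,2)}`, whose orthogonality annihilates all but the value at `z`
(`setIntegral_jacobi_bary`). Hence `M_{η,n}(𝒯)` is the orthogonal complement in `ℙ_{n,0}(𝒯)` of the
functions `(b_{n,z})_mvz`, `z` critical (`mem_pressure_iff`). These are linearly independent: a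
combination of critical functions that is constant is trivial already on every single triangle
(`coeff_eq_zero_of_sum_b_eq_const`).

The bound `η₀` enters through the parity of `N_z`. Shape regularity bounds the sines of all angles
from below (`le_sin_angle`), so for small `η` consecutive angles at a critical vertex add up to
nearly `π`, and five or more triangles at `z` would overlap (`N_le_four`). Thus `N_z` is even if `z`
is critical but not super-critical, and then `b_{n,z}` has mean zero, since its pairing with the
constant function is a multiple of `A_{𝒯,z}(1) = 0`. The Robinson property makes the critical
function of a super-critical vertex orthogonal to all other critical functions
(`IsRobinson.inner_b_eq_zero`). With these facts the candidates are seen to lie in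
`M^mod_{η,n}(𝒯)^⊥` by direct computation (`b_mem_modPressurePerp`, `varphi_mem_modPressurePerp`).

Modulo `M_{η,n}(𝒯)`, each candidate is a nonzero multiple of `(b_{n,z})_mvz`, and `M_{η,n}(𝒯)` meets
`M^mod_{η,n}(𝒯)^⊥` trivially (`eq_zero_of_mem_modPressurePerp`). By orthogonal projection onto the
span of the `(b_{n,z})_mvz`, this forces the candidates to be a basis
(`exists_basis_of_sub_smul_mem`).
-/

noncomputable section

namespace PressureWired

open scoped Classical Topology

/-! ### Moments of the Jacobi polynomial -/

theorem integral_pow_mul_one_sub_pow (a b : ℕ) :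
    ∫ u in (0 : ℝ)..1, u ^ a * (1 - u) ^ b
      = (a.factorial * b.factorial : ℝ) / (a + b + 1).factorial := by
  induction b generalizing a with
  | zero =>
    have : ((a + 1).factorial : ℝ) = (a + 1) * a.factorial := by
      rw [Nat.factorial_succ]; push_cast; ring
    have h := Nat.cast_ne_zero (R := ℝ).2 a.factorial_ne_zero
    simp only [pow_zero, mul_one, add_zero, Nat.factorial_zero, Nat.cast_one, integral_pow, this]
    field_simp
    simp
  | succ b ih =>
    have hd : ∀ u ∈ Set.uIcc (0 : ℝ) 1, HasDerivAt (fun u : ℝ => u ^ (a + 1) * (1 - u) ^ (b + 1))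
        ((a + 1) * (u ^ a * (1 - u) ^ (b + 1)) - (b + 1) * (u ^ (a + 1) * (1 - u) ^ b)) u := by
      intro u _
      refine ((hasDerivAt_pow (a + 1) u).mul
        (((hasDerivAt_id u).const_sub 1).pow (b + 1))).congr_deriv ?_
      simp only [Pi.pow_apply, id, Nat.add_sub_cancel]
      push_cast
      ring
    have h := intervalIntegral.integral_eq_sub_of_hasDerivAt hd
      (Continuous.intervalIntegrable (by fun_prop) _ _)
    rw [intervalIntegral.integral_sub (Continuous.intervalIntegrable (by fun_prop) _ _)
      (Continuous.intervalIntegrable (by fun_prop) _ _), intervalIntegral.integral_const_mul,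
      intervalIntegral.integral_const_mul, ih (a + 1)] at h
    have e : ((a + 1).factorial : ℝ) = (a + 1) * a.factorial := by
      rw [Nat.factorial_succ]; push_cast; ring
    have e' : ((b + 1).factorial : ℝ) = (b + 1) * b.factorial := by
      rw [Nat.factorial_succ]; push_cast; ring
    have ha : (a + 1 : ℝ) ≠ 0 := by positivity
    have hab : a + 1 + b + 1 = a + (b + 1) + 1 := by ring
    rw [hab, e] at h
    have h2 := Nat.cast_ne_zero (R := ℝ).2 (a + (b + 1) + 1).factorial_ne_zero
    rw [e']
    apply mul_left_cancel₀ ha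
    rw [sub_eq_iff_eq_add] at h
    simp only [one_pow, sub_self, ne_eq, Nat.add_eq_zero_iff, one_ne_zero, and_false,
      not_false_eq_true, zero_pow, mul_zero, zero_mul] at h
    rw [h]
    ring

theorem jacobi_eval (n : ℕ) (u : ℝ) :
    (jacobi 0 2 n).eval (2 * u - 1) = ∑ s ∈ Finset.range (n + 1),
      ((-1) ^ s * (n.choose s : ℝ) * ((n + 2).choose s : ℝ)) * (u ^ (n - s) * (1 - u) ^ s) := by
  unfold jacobi
  rw [Polynomial.eval_finsetSum]
  refine Finset.sum_congr rfl fun s hs => ?_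
  have hs' : s ≤ n := Nat.lt_succ_iff.1 (Finset.mem_range.1 hs)
  simp only [add_zero, Polynomial.eval_mul, Polynomial.eval_C, Polynomial.eval_pow,
    Polynomial.eval_sub, Polynomial.eval_add, Polynomial.eval_X, Polynomial.eval_one,
    Nat.choose_symm hs']
  have h1 : (1 / 2 : ℝ) * (2 * u - 1 - 1) = -1 * (1 - u) := by ring
  have h2 : (1 / 2 : ℝ) * (2 * u - 1 + 1) = u := by ring
  rw [h1, h2, mul_pow]
  ring

theorem natDegree_jacobi_le (n : ℕ) : (jacobi 0 2 n).natDegree ≤ n := by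
  unfold jacobi
  refine Polynomial.natDegree_sum_le_of_forall_le _ _ fun s hs => ?_
  have hs' : s ≤ n := Nat.lt_succ_iff.1 (Finset.mem_range.1 hs)
  calc _ ≤ (s + (n - s)) := by compute_degree
    _ = n := by omega

theorem jacobi_eval_one (n : ℕ) : (jacobi 0 2 n).eval 1 = 1 := by
  have h := jacobi_eval n 1
  rw [show (2 * 1 - 1 : ℝ) = 1 by norm_num] at h
  rw [h, Finset.sum_eq_single 0] <;> simp +contextual

theorem jacobi_eval_neg_one (n : ℕ) :
    (jacobi 0 2 n).eval (-1) = (-1) ^ n * ((n + 2).choose 2 : ℝ) := by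
  have h := jacobi_eval n 0
  rw [show (2 * 0 - 1 : ℝ) = -1 by norm_num] at h
  rw [h, Finset.sum_eq_single n]
  · have : (n + 2).choose n = (n + 2).choose 2 := by
      rw [← Nat.choose_symm_add]
    simp [this]
  · intro s hs hsn
    have hs' : s < n := lt_of_le_of_ne (Nat.lt_succ_iff.1 (Finset.mem_range.1 hs)) hsn
    rw [zero_pow (by omega)]; simp
  · simp

/-- The moments of the shifted Jacobi polynomial as an alternating binomial sum. -/
theorem integral_pow_mul_jacobi (n m : ℕ) :
    ∫ u in (0 : ℝ)..1, u ^ m * (jacobi 0 2 n).eval (2 * u - 1)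
      = ∑ s ∈ Finset.range (n + 1), ((-1) ^ s * (n.choose s : ℝ) * ((n + 2).choose s : ℝ)) *
        (((n - s + m).factorial * s.factorial : ℝ) / (n + m + 1).factorial) := by
  simp only [jacobi_eval, Finset.mul_sum]
  rw [intervalIntegral.integral_finsetSum
    fun s _ => Continuous.intervalIntegrable (by fun_prop) _ _]
  refine Finset.sum_congr rfl fun s hs => ?_
  have hs' : s ≤ n := Nat.lt_succ_iff.1 (Finset.mem_range.1 hs)
  have := integral_pow_mul_one_sub_pow (n - s + m) s
  rw [show n - s + m + s + 1 = n + m + 1 by omega] at this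
  rw [← this, ← intervalIntegral.integral_const_mul]
  congr 1 with u
  ring

/-- The shifted Jacobi polynomial is orthogonal to `u ^ j`, `j < n`, for the weight `u ^ 2`:
up to factors independent of `s`, the `s`-th term of the moment is `(-1) ^ s * n.choose s` times the
value at `s` of a polynomial of degree `j`, so the sum is an `n`-th finite difference of it. -/
theorem integral_pow_add_two_mul_jacobi (n j : ℕ) (hj : j < n) :
    ∫ u in (0 : ℝ)..1, u ^ (j + 2) * (jacobi 0 2 n).eval (2 * u - 1) = 0 := by
  rw [integral_pow_mul_jacobi]
  let Q : Polynomial ℝ := ∏ i ∈ Finset.range j, (Polynomial.C ((n : ℝ) + 3 + i) - Polynomial.X)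
  have hQ : Q.natDegree < n := by
    refine lt_of_le_of_lt (Polynomial.natDegree_prod_le _ _) ?_
    refine lt_of_le_of_lt (Finset.sum_le_card_nsmul _ _ 1 fun i _ => ?_) (by simpa using hj)
    compute_degree
  have h0 := congrFun (Polynomial.fwdDiff_iter_eq_zero_of_degree_lt hQ) 0
  rw [fwdDiff_iter_eq_sum_shift] at h0
  have hterm : ∀ s ∈ Finset.range (n + 1),
      ((-1) ^ s * (n.choose s : ℝ) * ((n + 2).choose s : ℝ)) *
        (((n - s + (j + 2)).factorial * s.factorial : ℝ) / (n + (j + 2) + 1).factorial)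
      = ((-1) ^ n * (n + 2).factorial / (n + (j + 2) + 1).factorial : ℝ) *
        (((-1 : ℤ) ^ (n - s) * (n.choose s : ℤ)) • Q.eval (0 + s • (1 : ℝ))) := by
    intro s hs
    have hs' : s ≤ n := Nat.lt_succ_iff.1 (Finset.mem_range.1 hs)
    have h1 : Q.eval (s : ℝ) * ((n + 2 - s).factorial : ℝ) = (n - s + (j + 2)).factorial := by
      have h3 := Nat.factorial_mul_ascFactorial (n + 2 - s) j
      rw [show n + 2 - s + j = n - s + (j + 2) by omega] at h3
      rw [← h3, Nat.ascFactorial_eq_prod_range, Polynomial.eval_prod]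
      push_cast
      rw [mul_comm]
      congr 1
      refine Finset.prod_congr rfl fun i _ => ?_
      rw [Nat.cast_sub (by omega)]
      simp
      ring
    have h2 : ((n + 2).choose s : ℝ) * s.factorial * (n + 2 - s).factorial = (n + 2).factorial := by
      exact_mod_cast Nat.choose_mul_factorial_mul_factorial (by omega : s ≤ n + 2)
    have h4 : ((-1 : ℝ)) ^ n * (-1) ^ (n - s) = (-1) ^ s := by
      rw [← pow_add, show n + (n - s) = 2 * (n - s) + s by omega, pow_add, pow_mul]; simp
    have h5 := Nat.cast_ne_zero (R := ℝ).2 (n + (j + 2) + 1).factorial_ne_zero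
    simp only [nsmul_eq_mul, mul_one, zero_add, zsmul_eq_mul]
    push_cast
    rw [← h1, ← h2, ← h4]
    field_simp
  rw [Finset.sum_congr rfl hterm, ← Finset.mul_sum, h0]
  simp

/-- The first moment: its `s`-th summand is the integral of a term of the binomial expansion of
`u * (1 - u) ^ n`. -/
theorem integral_mul_jacobi (n : ℕ) :
    ∫ u in (0 : ℝ)..1, u * (jacobi 0 2 n).eval (2 * u - 1)
      = (-1) ^ n / (2 * ((n + 2).choose 2 : ℝ)) := by
  have h := integral_pow_mul_jacobi n 1
  simp only [pow_one] at h
  rw [h]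
  have hc : ∀ m : ℕ, ((m + 2).choose 2 : ℝ) * 2 = (m + 1) * (m + 2) := by
    intro m
    rw [Nat.cast_choose_two]
    push_cast
    ring
  have hterm : ∀ s ∈ Finset.range (n + 1),
      ((-1) ^ s * (n.choose s : ℝ) * ((n + 2).choose s : ℝ)) *
        (((n - s + 1).factorial * s.factorial : ℝ) / (n + 1 + 1).factorial)
      = ∫ u in (0 : ℝ)..1, u * ((-u) ^ (n - s) * 1 ^ s * (n.choose (n - s) : ℝ)) * (-1) ^ n := by
    intro s hs
    have hs' : s ≤ n := Nat.lt_succ_iff.1 (Finset.mem_range.1 hs)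
    have h1 : (fun u : ℝ => u * ((-u) ^ (n - s) * 1 ^ s * (n.choose (n - s) : ℝ)) * (-1) ^ n)
        = fun u => ((-1) ^ s * (n.choose s : ℝ)) * u ^ (n - s + 1) := by
      have h4 : ((-1 : ℝ)) ^ n * (-1) ^ (n - s) = (-1) ^ s := by
        rw [← pow_add, show n + (n - s) = 2 * (n - s) + s by omega, pow_add, pow_mul]; simp
      funext u
      rw [neg_pow u, Nat.choose_symm hs', ← h4]
      ring
    have h2 : ((n + 2).choose s : ℝ) * s.factorial * (n + 2 - s).factorial = (n + 2).factorial := by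
      exact_mod_cast Nat.choose_mul_factorial_mul_factorial (by omega : s ≤ n + 2)
    have h3 : ((n + 2 - s).factorial : ℝ) = ((n - s + 1 : ℕ) + 1) * (n - s + 1).factorial := by
      rw [show n + 2 - s = (n - s + 1) + 1 by omega, Nat.factorial_succ]; push_cast; ring
    rw [h1, intervalIntegral.integral_const_mul, integral_pow, ← h2, h3]
    have := Nat.cast_ne_zero (R := ℝ).2 s.factorial_ne_zero
    have := Nat.cast_ne_zero (R := ℝ).2 (n - s + 1).factorial_ne_zero
    have : (((n + 2).choose s : ℕ) : ℝ) ≠ 0 :=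
      Nat.cast_ne_zero.2 (Nat.choose_pos (by omega : s ≤ n + 2)).ne'
    have : ((n - s + 1 : ℕ) : ℝ) + 1 ≠ 0 := by positivity
    simp only [one_pow, ne_eq, Nat.add_eq_zero_iff, one_ne_zero, and_false, not_false_eq_true,
      zero_pow, sub_zero]
    field_simp
  rw [Finset.sum_congr rfl hterm, ← intervalIntegral.integral_finsetSum
    fun s _ => Continuous.intervalIntegrable (by fun_prop) _ _]
  have hbin : (fun u : ℝ => ∑ s ∈ Finset.range (n + 1),
      u * ((-u) ^ (n - s) * 1 ^ s * (n.choose (n - s) : ℝ)) * (-1) ^ n)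
      = fun u => (u ^ 1 * (1 - u) ^ n) * (-1) ^ n := by
    funext u
    rw [← Finset.sum_mul, ← Finset.mul_sum, pow_one, sub_eq_neg_add, add_pow,
      ← Finset.sum_range_reflect]
    congr 2
    refine Finset.sum_congr rfl fun s hs => ?_
    have hs' : s ≤ n := Nat.lt_succ_iff.1 (Finset.mem_range.1 hs)
    rw [show n + 1 - 1 - s = n - s by omega, show n - (n - s) = s by omega]
  rw [hbin, intervalIntegral.integral_mul_const, integral_pow_mul_one_sub_pow]
  have h6 : ((1 + n + 1).factorial : ℝ) = (n + 1) * (n + 2) * n.factorial := by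
    rw [show 1 + n + 1 = (n + 1) + 1 by ring, Nat.factorial_succ, Nat.factorial_succ]
    push_cast; ring
  have h7 := hc n
  have := Nat.cast_ne_zero (R := ℝ).2 n.factorial_ne_zero
  rw [h6, mul_comm 2, h7]
  simp
  field_simp

/-- Against polynomials of degree at most `n` and with the weight `u`, the shifted Jacobi polynomial
acts as a multiple of the evaluation at `0`: the part divisible by `u` is annihilated by
orthogonality. -/
theorem integral_mul_jacobi_mul (n : ℕ) (R : Polynomial ℝ) (hR : R.natDegree ≤ n) :
    ∫ u in (0 : ℝ)..1, u * ((jacobi 0 2 n).eval (2 * u - 1) * R.eval u)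
      = (-1) ^ n / (2 * ((n + 2).choose 2 : ℝ)) * R.eval 0 := by
  have hJ : Continuous fun u : ℝ => (jacobi 0 2 n).eval (2 * u - 1) :=
    (Polynomial.continuous _).comp (by fun_prop)
  have h1 : (fun u : ℝ => u * ((jacobi 0 2 n).eval (2 * u - 1) * R.eval u))
      = fun u => ∑ i ∈ Finset.range (n + 1),
        R.coeff i * (u ^ (i + 1) * (jacobi 0 2 n).eval (2 * u - 1)) := by
    funext u
    rw [Polynomial.eval_eq_sum_range' (Nat.lt_succ_of_le hR), Finset.mul_sum, Finset.mul_sum]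
    refine Finset.sum_congr rfl fun i _ => by ring
  rw [h1, intervalIntegral.integral_finsetSum
    fun s _ => Continuous.intervalIntegrable (by fun_prop) _ _, Finset.sum_range_succ']
  simp only [intervalIntegral.integral_const_mul]
  rw [Finset.sum_eq_zero fun j hj => by
    rw [show j + 1 + 1 = j + 2 by ring,
      integral_pow_add_two_mul_jacobi n j (Finset.mem_range.1 hj), mul_zero]]
  simp only [zero_add, pow_one, integral_mul_jacobi, Polynomial.coeff_zero_eq_eval_zero]
  ring

/-! ### Integration over a triangle -/

theorem mem_hull_triple {z a b x : Plane} :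
    x ∈ hull {z, a, b} ↔
      ∃ s t : ℝ, 0 ≤ s ∧ 0 ≤ t ∧ s + t ≤ 1 ∧ x = z + s • (a - z) + t • (b - z) := by
  have hc : (({z, a, b} : Finset Plane) : Set Plane) = {z, a, b} := by push_cast; rfl
  rw [hull, hc, convexHull_insert (Set.insert_nonempty _ _), convexHull_pair, mem_convexJoin]
  simp only [Set.mem_singleton_iff, exists_eq_left]
  constructor
  · rintro ⟨y, ⟨p, q, hp, hq, hpq, rfl⟩, ⟨c, d, hc, hd, hcd, rfl⟩⟩
    refine ⟨d * p, d * q, by positivity, by positivity, ?_, ?_⟩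
    · rw [← mul_add, hpq]; linarith
    · obtain rfl : c = 1 - d := by linarith
      obtain rfl : p = 1 - q := by linarith
      module
  · rintro ⟨s, t, hs, ht, hst, rfl⟩
    rcases eq_or_lt_of_le (add_nonneg hs ht) with h | h
    · obtain rfl : s = 0 := by linarith
      obtain rfl : t = 0 := by linarith
      exact ⟨a, left_mem_segment _ _ _, by simpa using left_mem_segment ℝ z a⟩
    · refine ⟨(s / (s + t)) • a + (t / (s + t)) • b,
        ⟨_, _, by positivity, by positivity, by field_simp, rfl⟩,
        ⟨1 - (s + t), s + t, by linarith, h.le, by ring, ?_⟩⟩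
      rw [smul_add, smul_smul, smul_smul, mul_div_cancel₀ _ h.ne', mul_div_cancel₀ _ h.ne']
      module

/-- The linear map sending the standard basis of the plane to `v, w`. -/
def ofColumns (v w : Plane) : Plane →L[ℝ] Plane :=
  (EuclideanSpace.proj (0 : Fin 2) : Plane →L[ℝ] ℝ).smulRight v +
    (EuclideanSpace.proj (1 : Fin 2) : Plane →L[ℝ] ℝ).smulRight w

theorem ofColumns_apply (v w y : Plane) : ofColumns v w y = y 0 • v + y 1 • w := rfl

theorem det_ofColumns (v w : Plane) : (ofColumns v w).det = cross v w := by
  rw [ContinuousLinearMap.det, ← LinearMap.det_toMatrix (EuclideanSpace.basisFun (Fin 2) ℝ).toBasis,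
    Matrix.det_fin_two]
  simp [LinearMap.toMatrix_apply, ofColumns_apply, cross]
  ring

/-- The coordinate map, as a measurable equivalence between the plane and `ℝ × ℝ`. -/
def planeEquiv : Plane ≃ᵐ ℝ × ℝ :=
  (MeasurableEquiv.toLp 2 (Fin 2 → ℝ)).symm.trans MeasurableEquiv.finTwoArrow

theorem planeEquiv_apply (x : Plane) : planeEquiv x = (x 0, x 1) := rfl

theorem measurePreserving_planeEquiv : MeasurePreserving planeEquiv volume volume :=
  (volume_preserving_finTwoArrow ℝ).comp
    (EuclideanSpace.volume_preserving_symm_measurableEquiv_toLp (Fin 2))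

theorem isCompact_lowerTriangle : IsCompact {p : ℝ × ℝ | 0 ≤ p.2 ∧ p.2 ≤ p.1 ∧ p.1 ≤ 1} := by
  refine (isCompact_Icc (a := ((0 : ℝ), (0 : ℝ)))
    (b := ((1 : ℝ), (1 : ℝ)))).of_isClosed_subset ?_ ?_
  · exact (isClosed_le continuous_const continuous_snd).inter
      ((isClosed_le continuous_snd continuous_fst).inter
        (isClosed_le continuous_fst continuous_const))
  · rintro ⟨u, w⟩ ⟨h1, h2, h3⟩
    exact ⟨⟨h1.trans h2, h1⟩, ⟨h3, h2.trans h3⟩⟩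

theorem setIntegral_lowerTriangle (G : ℝ × ℝ → ℝ) (hG : Continuous G) :
    ∫ p in {p : ℝ × ℝ | 0 ≤ p.2 ∧ p.2 ≤ p.1 ∧ p.1 ≤ 1}, G p
      = ∫ u in (0 : ℝ)..1, ∫ w in (0 : ℝ)..u, G (u, w) := by
  have hm := isCompact_lowerTriangle.measurableSet
  rw [← integral_indicator hm, Measure.volume_eq_prod, integral_prod]
  · rw [intervalIntegral.integral_of_le zero_le_one, ← integral_Icc_eq_integral_Ioc,
      ← integral_indicator measurableSet_Icc]
    congr 1 with u
    by_cases hu : u ∈ Set.Icc (0 : ℝ) 1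
    · rw [Set.indicator_of_mem hu, intervalIntegral.integral_of_le hu.1,
        ← integral_Icc_eq_integral_Ioc, ← integral_indicator measurableSet_Icc]
      congr 1 with w
      simp only [Set.indicator_apply, Set.mem_ofPred_eq, Set.mem_Icc]
      have := hu.2
      simp [this]
    · rw [Set.indicator_of_notMem hu]
      convert integral_zero ℝ ℝ with w
      refine Set.indicator_of_notMem (fun h => hu ⟨h.1.trans h.2.1, h.2.2⟩) _
  · exact (integrable_indicator_iff hm).2 (hG.continuousOn.integrableOn_compact
      isCompact_lowerTriangle)

/-- Integration over a triangle in Duffy coordinates centred at the vertex `z`. -/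
theorem setIntegral_hull {z a b : Plane} (hD : cross (a - z) (b - z) ≠ 0) (F : Plane → ℝ)
    (hF : Continuous F) :
    ∫ x in hull {z, a, b}, F x = |cross (a - z) (b - z)| *
      ∫ t in (0 : ℝ)..1, ∫ u in (0 : ℝ)..1, u * F (z + u • ((a - z) + t • (b - a))) := by
  -- the triangle is the affine image of `{0 ≤ y₁ ≤ y₀ ≤ 1}`; afterwards `y₁ = t * y₀`
  let R : Set Plane := planeEquiv ⁻¹' {p : ℝ × ℝ | 0 ≤ p.2 ∧ p.2 ≤ p.1 ∧ p.1 ≤ 1}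
  let Φ : Plane → Plane := fun y => z + ofColumns (a - z) (b - a) y
  have hdet : cross (a - z) (b - a) = cross (a - z) (b - z) := by
    simp only [cross, PiLp.sub_apply]; ring
  have himg : hull {z, a, b} = Φ '' R := by
    ext x
    rw [mem_hull_triple]
    constructor
    · rintro ⟨s, t, hs, ht, hst, rfl⟩
      refine ⟨planeEquiv.symm (s + t, t), ?_, ?_⟩
      · simpa [R] using ⟨ht, hs, hst⟩
      · have h := planeEquiv_apply (planeEquiv.symm (s + t, t))
        rw [MeasurableEquiv.apply_symm_apply, Prod.mk.injEq] at h
        simp only [Φ, ofColumns_apply, ← h.1, ← h.2]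
        module
    · rintro ⟨y, ⟨h1, h2, h3⟩, rfl⟩
      rw [planeEquiv_apply] at h1 h2 h3
      refine ⟨y 0 - y 1, y 1, sub_nonneg.2 h2, h1, by simpa using h3, ?_⟩
      simp only [Φ, ofColumns_apply]
      module
  have hinj : Function.Injective (ofColumns (a - z) (b - a)) := by
    have : IsUnit (ofColumns (a - z) (b - a)).det := by
      rw [det_ofColumns, hdet]; exact isUnit_iff_ne_zero.2 hD
    exact ((Module.End.isUnit_iff _).1 ((LinearMap.isUnit_iff_isUnit_det _).2 this)).1
  have hder : ∀ x ∈ R, HasFDerivWithinAt Φ (ofColumns (a - z) (b - a)) R x := fun x _ =>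
    ((ofColumns (a - z) (b - a)).hasFDerivWithinAt).const_add z
  have hRm : MeasurableSet R :=
    planeEquiv.measurable isCompact_lowerTriangle.measurableSet
  rw [himg, integral_image_eq_integral_abs_det_fderiv_smul volume hRm hder
    (fun x _ y _ h => hinj (add_left_cancel h))]
  simp only [det_ofColumns, hdet, smul_eq_mul]
  rw [integral_const_mul]
  congr 1
  have h1 : ∫ y in R, F (Φ y) = ∫ p in {p : ℝ × ℝ | 0 ≤ p.2 ∧ p.2 ≤ p.1 ∧ p.1 ≤ 1},
      F (z + p.1 • (a - z) + p.2 • (b - a)) := by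
    rw [← measurePreserving_planeEquiv.setIntegral_preimage_emb planeEquiv.measurableEmbedding]
    refine integral_congr_ae (Filter.Eventually.of_forall fun y => ?_)
    simp only [Φ, ofColumns_apply, planeEquiv_apply, add_assoc]
  rw [h1, setIntegral_lowerTriangle _ (by fun_prop)]
  have h2 : ∀ u : ℝ, ∫ w in (0 : ℝ)..u, F (z + u • (a - z) + w • (b - a))
      = ∫ t in (0 : ℝ)..1, u * F (z + u • ((a - z) + t • (b - a))) := by
    intro u
    have := intervalIntegral.smul_integral_comp_mul_left (a := 0) (b := 1)
      (fun w => F (z + u • (a - z) + w • (b - a))) u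
    rw [mul_zero, mul_one] at this
    rw [← this, smul_eq_mul, ← intervalIntegral.integral_const_mul]
    simp only [smul_add, smul_smul, add_assoc]
  simp only [h2]
  simp only [intervalIntegral.integral_of_le zero_le_one]
  refine integral_integral_swap ?_
  rw [Measure.prod_restrict]
  refine IntegrableOn.mono_set (t := Set.Icc 0 1 ×ˢ Set.Icc 0 1) ?_
    (Set.prod_mono Set.Ioc_subset_Icc_self Set.Ioc_subset_Icc_self)
  refine ContinuousOn.integrableOn_compact (isCompact_Icc.prod isCompact_Icc) ?_
  exact Continuous.continuousOn (by unfold Function.uncurry; fun_prop)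

theorem volume_hull {z a b : Plane} (hD : cross (a - z) (b - z) ≠ 0) :
    volume.real (hull {z, a, b}) = |cross (a - z) (b - z)| / 2 := by
  have h := setIntegral_hull hD (fun _ => 1) continuous_const
  rw [setIntegral_const] at h
  simp only [smul_eq_mul, mul_one, integral_id, intervalIntegral.integral_const] at h
  rw [h]
  norm_num
  ring

theorem continuous_mvPolynomial_eval (q : MvPolynomial (Fin 2) ℝ) :
    Continuous fun x : Plane => MvPolynomial.eval (fun i => x i) q :=
  (MvPolynomial.continuous_eval q).comp (by fun_prop)

theorem continuous_bary (z a b : Plane) : Continuous (bary z a b) := by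
  unfold bary cross
  simp only [PiLp.sub_apply]
  fun_prop

theorem continuous_jacobi_bary (n : ℕ) (z a b : Plane) :
    Continuous fun x : Plane => (jacobi 0 2 n).eval (1 - 2 * bary z a b x) :=
  (Polynomial.continuous _).comp (by have := continuous_bary z a b; fun_prop)

theorem bary_line {z a b : Plane} (hD : cross (a - z) (b - z) ≠ 0) (u t : ℝ) :
    bary z a b (z + u • ((a - z) + t • (b - a))) = 1 - u := by
  unfold bary
  rw [div_eq_iff hD]
  simp only [cross, PiLp.sub_apply, PiLp.add_apply, PiLp.smul_apply, smul_eq_mul]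
  ring

/-- On a triangle, the integral against the Jacobi polynomial in the barycentric coordinate of the
vertex `z` is a multiple of the evaluation at `z`, for all polynomials of degree at most `n`: along
each ray through `z` this is the one-dimensional orthogonality. -/
theorem setIntegral_jacobi_bary {z a b : Plane} (hD : cross (a - z) (b - z) ≠ 0) (n : ℕ)
    (q : MvPolynomial (Fin 2) ℝ) (hq : q.totalDegree ≤ n) :
    ∫ x in hull {z, a, b}, (jacobi 0 2 n).eval (1 - 2 * bary z a b x) *
        MvPolynomial.eval (fun i => x i) q
      = volume.real (hull {z, a, b}) * ((-1) ^ n / ((n + 2).choose 2 : ℝ)) *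
        MvPolynomial.eval (fun i => z i) q := by
  rw [setIntegral_hull hD (fun x => (jacobi 0 2 n).eval (1 - 2 * bary z a b x) *
    MvPolynomial.eval (fun i => x i) q) ((continuous_jacobi_bary n z a b).mul
      (continuous_mvPolynomial_eval q)), volume_hull hD]
  have h1 : ∀ t : ℝ, ∫ u in (0 : ℝ)..1, u * ((jacobi 0 2 n).eval
      (1 - 2 * bary z a b (z + u • ((a - z) + t • (b - a)))) *
        MvPolynomial.eval (fun i => (z + u • ((a - z) + t • (b - a))) i) q)
      = (-1) ^ n / (2 * ((n + 2).choose 2 : ℝ)) * MvPolynomial.eval (fun i => z i) q := by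
    intro t
    -- the restriction of `q` to a ray through `z`
    let R : Polynomial ℝ := MvPolynomial.aeval
      (fun i => Polynomial.C (z i) + Polynomial.C (((a - z) + t • (b - a)) i) * Polynomial.X) q
    have hR : R.natDegree ≤ n := by
      have := MvPolynomial.aeval_natDegree_le q hq
        (fun i => Polynomial.C (z i) + Polynomial.C (((a - z) + t • (b - a)) i) * Polynomial.X)
        (n := 1) (fun i => by compute_degree)
      rwa [mul_one] at this
    have hRe : ∀ u, R.eval u
        = MvPolynomial.eval (fun i => (z + u • ((a - z) + t • (b - a))) i) q := by
      intro u
      have : ∀ r : MvPolynomial (Fin 2) ℝ, Polynomial.eval u (MvPolynomial.aeval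
          (fun i => Polynomial.C (z i) + Polynomial.C (((a - z) + t • (b - a)) i) * Polynomial.X) r)
          = MvPolynomial.eval (fun i => (z + u • ((a - z) + t • (b - a))) i) r := by
        intro r
        induction r using MvPolynomial.induction_on with
        | C c => simp
        | add p q hp hq => simp only [map_add, Polynomial.eval_add, hp, hq]
        | mul_X p i hp =>
          simp only [map_mul, Polynomial.eval_mul, hp, MvPolynomial.aeval_X, MvPolynomial.eval_X]
          congr 1
          simp
          ring
      exact this q
    have h := integral_mul_jacobi_mul n R hR
    rw [hRe 0] at h
    simp only [zero_smul, add_zero] at h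
    rw [← h]
    refine intervalIntegral.integral_congr fun u _ => ?_
    simp only
    rw [bary_line hD, hRe u]
    ring_nf
  simp only [h1, intervalIntegral.integral_const]
  simp
  field_simp

/-! ### Piecewise polynomials on the mesh -/

theorem volume_segment (x y : Plane) : volume (segment ℝ x y) = 0 := by
  have hne : line[ℝ, x, y] ≠ ⊤ := by
    intro h
    have h1 := (collinear_pair ℝ x y)
    rw [collinear_iff_finrank_le_one, ← direction_affineSpan, h, AffineSubspace.direction_top,
      finrank_top, finrank_euclideanSpace] at h1
    simp at h1
  refine measure_mono_null ?_ (Measure.addHaar_affineSubspace volume _ hne)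
  rw [← convexHull_pair]
  exact convexHull_subset_affineSpan _

theorem volume_hull_of_card_le_two {s : Finset Plane} (hs : s.card ≤ 2) : volume (hull s) = 0 := by
  obtain h | h | h : s.card = 0 ∨ s.card = 1 ∨ s.card = 2 := by omega
  · rw [Finset.card_eq_zero] at h; subst h; simp [hull]
  · obtain ⟨x, rfl⟩ := Finset.card_eq_one.1 h; simp [hull]
  · obtain ⟨x, y, -, rfl⟩ := Finset.card_eq_two.1 h
    rw [hull, Finset.coe_pair, convexHull_pair, volume_segment]

theorem Domain.volume_frontier (Ω : Domain) : volume (frontier Ω.carrier) = 0 := by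
  obtain ⟨S, hS⟩ := Ω.polygonal
  rw [hS]
  exact (measure_biUnion_null_iff S.countable_toSet).2 fun s _ => volume_segment _ _

theorem isCompact_hull (K : Finset Plane) : IsCompact (hull K) :=
  (Finset.finite_toSet _).isCompact_convexHull (𝕜 := ℝ)

theorem volume_frontier_hull (K : Finset Plane) : volume (frontier (hull K)) = 0 :=
  (convex_convexHull ℝ _).addHaar_frontier volume

/-- Two polynomials that agree almost everywhere on a nonempty open set are equal. -/
theorem mvPolynomial_eq_of_ae {U : Set Plane} (hU : IsOpen U) (hne : U.Nonempty)
    {p q : MvPolynomial (Fin 2) ℝ}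
    (h : ∀ᵐ x ∂(volume : Measure Plane), x ∈ U →
      MvPolynomial.eval (fun i => x i) p = MvPolynomial.eval (fun i => x i) q) : p = q := by
  have h1 := Measure.eqOn_open_of_ae_eq ((ae_restrict_iff' hU.measurableSet).2 h) hU
    (continuous_mvPolynomial_eval p).continuousOn (continuous_mvPolynomial_eval q).continuousOn
  obtain ⟨x, hx⟩ := hne
  have hV : IsOpen ((WithLp.toLp 2 : (Fin 2 → ℝ) → Plane) ⁻¹' U) :=
    hU.preimage (PiLp.continuous_toLp 2 _)
  obtain ⟨ε, hε, hball⟩ := Metric.isOpen_iff.1 hV (fun i => x i) hx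
  refine MvPolynomial.funext_set (fun i => Metric.ball (x i) ε) (fun i => ?_) fun y hy => ?_
  · rw [Real.ball_eq_Ioo]; exact Set.Ioo_infinite (by linarith)
  · rw [← ball_pi _ hε] at hy
    exact h1 (hball hy)

namespace Triangulation

variable {Ω : Domain} {T : Triangulation Ω}

theorem mem_vertices {z : Plane} : z ∈ T.vertices ↔ ∃ K ∈ T.triangles, z ∈ K := by
  simp [vertices]

theorem mem_patch {z : Plane} {K : Finset Plane} :
    K ∈ T.patch z ↔ K ∈ T.triangles ∧ z ∈ hull K := Finset.mem_filter

namespace Numbering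

variable (σ : T.Numbering)

theorem tri_mem_patch {z : Plane} (hz : z ∈ T.vertices) {ℓ : ℕ} (hℓ : ℓ < T.N z) :
    σ.tri z ℓ ∈ T.patch z := by
  rw [← σ.enum z hz]
  exact Finset.mem_image_of_mem (fun ℓ => ({z, σ.pt z ℓ, σ.pt z (ℓ + 1)} : Finset Plane))
    (Finset.mem_range.2 hℓ)

theorem tri_mem {z : Plane} (hz : z ∈ T.vertices) {ℓ : ℕ} (hℓ : ℓ < T.N z) :
    σ.tri z ℓ ∈ T.triangles := (mem_patch.1 (σ.tri_mem_patch hz hℓ)).1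

theorem exists_tri_eq {z : Plane} (hz : z ∈ T.vertices) {K : Finset Plane} (hK : K ∈ T.patch z) :
    ∃ ℓ < T.N z, K = σ.tri z ℓ := by
  rw [← σ.enum z hz] at hK
  obtain ⟨ℓ, hℓ, rfl⟩ := Finset.mem_image.1 hK
  exact ⟨ℓ, Finset.mem_range.1 hℓ, rfl⟩

theorem tri_injOn {z : Plane} (hz : z ∈ T.vertices) :
    Set.InjOn (σ.tri z) (Finset.range (T.N z)) := by
  refine Finset.card_image_iff.1 ?_
  rw [Finset.card_range]
  exact congrArg Finset.card (σ.enum z hz)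

theorem cross_ne_zero {z : Plane} (hz : z ∈ T.vertices) {ℓ : ℕ} (hℓ : ℓ < T.N z) :
    cross (σ.pt z ℓ - z) (σ.pt z (ℓ + 1) - z) ≠ 0 := (σ.ccw z hz ℓ hℓ).ne'

theorem mem_of_mem_patch (σ : T.Numbering) {z : Plane} (hz : z ∈ T.vertices) {K : Finset Plane}
    (hK : K ∈ T.patch z) : z ∈ K := by
  obtain ⟨ℓ, -, rfl⟩ := σ.exists_tri_eq hz hK
  simp [tri]

theorem mem_patch_iff (σ : T.Numbering) {z : Plane} (hz : z ∈ T.vertices) {K : Finset Plane} :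
    K ∈ T.patch z ↔ K ∈ T.triangles ∧ z ∈ K :=
  ⟨fun h => ⟨(mem_patch.1 h).1, σ.mem_of_mem_patch hz h⟩,
    fun h => mem_patch.2 ⟨h.1, subset_convexHull ℝ _ (Finset.mem_coe.2 h.2)⟩⟩

/-- The numbering provides the positive orientation of every triangle, hence its positive area. -/
theorem volume_hull_pos (σ : T.Numbering) {K : Finset Plane} (hK : K ∈ T.triangles) :
    0 < volume.real (hull K) := by
  obtain ⟨z, hz⟩ : K.Nonempty := Finset.card_pos.1 (by rw [T.card_eq K hK]; norm_num)
  have hzv : z ∈ T.vertices := mem_vertices.2 ⟨K, hK, hz⟩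
  obtain ⟨ℓ, hℓ, rfl⟩ := σ.exists_tri_eq hzv ((σ.mem_patch_iff hzv).2 ⟨hK, hz⟩)
  have h := σ.ccw z hzv ℓ hℓ
  rw [tri, volume_hull h.ne']
  positivity

theorem interior_inter_nonempty (σ : T.Numbering) {K : Finset Plane} (hK : K ∈ T.triangles) :
    (interior (hull K) ∩ Ω.carrier).Nonempty := by
  have h1 : (interior (hull K)).Nonempty := by
    by_contra h
    rw [Set.not_nonempty_iff_eq_empty] at h
    have h2 := σ.volume_hull_pos hK
    have h3 : volume (hull K) = 0 := measure_mono_null (fun x hx => by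
      rw [frontier, h, Set.sdiff_empty]; exact subset_closure hx) (volume_frontier_hull K)
    rw [measureReal_def, h3] at h2
    simp at h2
  obtain ⟨x, hx⟩ := h1
  have hx' : x ∈ closure Ω.carrier := by
    rw [← T.cover]
    exact Set.mem_biUnion hK (interior_subset hx)
  exact mem_closure_iff.1 hx' _ isOpen_interior hx

end Numbering

/-- As the boundary of `Ω` is a null set, triangles lie in `Ω` up to a null set. -/
theorem restrict_hull {K : Finset Plane} (hK : K ∈ T.triangles) :
    Ω.measure.restrict (hull K) = volume.restrict (hull K) := by
  rw [Measure.restrict_restrict (isCompact_hull K).measurableSet]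
  refine Measure.restrict_congr_set ?_
  have h : hull K \ Ω.carrier ⊆ frontier Ω.carrier := by
    intro x hx
    rw [frontier, Ω.isOpen.interior_eq]
    exact ⟨by rw [← T.cover]; exact Set.mem_biUnion hK hx.1, hx.2⟩
  have h0 : volume (hull K \ Ω.carrier) = 0 := measure_mono_null h Ω.volume_frontier
  filter_upwards [compl_mem_ae_iff.2 h0] with x hx
  refine propext ⟨fun h => h.1, fun h => ⟨h, ?_⟩⟩
  by_contra hxΩ
  exact hx ⟨h, hxΩ⟩

theorem ae_hull_of_ae_interior {K : Finset Plane} (hK : K ∈ T.triangles) {P : Plane → Prop}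
    (h : ∀ᵐ x ∂Ω.measure, x ∈ interior (hull K) → P x) :
    ∀ᵐ x ∂volume.restrict (hull K), P x := by
  have h1 : ∀ᵐ x ∂volume.restrict (hull K), x ∈ interior (hull K) → P x := by
    rw [← T.restrict_hull hK]
    exact ae_restrict_of_ae h
  have h2 : ∀ᵐ x ∂volume.restrict (hull K), x ∉ frontier (hull K) :=
    ae_restrict_of_ae (compl_mem_ae_iff.2 (volume_frontier_hull K))
  filter_upwards [h1, h2, ae_restrict_mem (isCompact_hull K).measurableSet] with x h1 h2 h3
  refine h1 ?_
  by_contra h4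
  exact h2 ⟨subset_closure h3, h4⟩

/-- Distinct triangles of the mesh overlap in a null set. -/
theorem ae_notMem_hull {K K' : Finset Plane} (hK : K ∈ T.triangles) (hK' : K' ∈ T.triangles)
    (hne : K ≠ K') : ∀ᵐ x ∂(volume : Measure Plane), x ∈ hull K → x ∉ hull K' := by
  have hc : (K ∩ K').card ≤ 2 := by
    by_contra! h
    have h1 := Finset.eq_of_subset_of_card_le (Finset.inter_subset_left (s₁ := K) (s₂ := K'))
      (by rw [T.card_eq K hK]; omega)
    have h2 := Finset.eq_of_subset_of_card_le (Finset.inter_subset_right (s₁ := K) (s₂ := K'))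
      (by rw [T.card_eq K' hK']; omega)
    exact hne (h1.symm.trans h2)
  have h0 := volume_hull_of_card_le_two hc
  rw [← T.conforming K hK K' hK'] at h0
  filter_upwards [compl_mem_ae_iff.2 h0] with x hx h1 h2
  exact hx ⟨h1, h2⟩

theorem integral_indicator_hull_mul {K : Finset Plane} (hK : K ∈ T.triangles) {F : Plane → ℝ}
    (hF : Continuous F) {q : Plane → ℝ} {p : MvPolynomial (Fin 2) ℝ}
    (hp : ∀ᵐ x ∂Ω.measure, x ∈ interior (hull K) → q x = MvPolynomial.eval (fun i => x i) p) :
    Integrable (fun x => (hull K).indicator F x * q x) Ω.measure ∧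
    ∫ x, (hull K).indicator F x * q x ∂Ω.measure
      = ∫ x in hull K, F x * MvPolynomial.eval (fun i => x i) p := by
  have hm := (isCompact_hull K).measurableSet
  have h1 : (fun x => (hull K).indicator F x * q x) = (hull K).indicator fun x => F x * q x := by
    funext x
    rw [Set.indicator_mul_left]
  have h2 : (fun x => F x * q x) =ᵐ[volume.restrict (hull K)]
      fun x => F x * MvPolynomial.eval (fun i => x i) p := by
    filter_upwards [T.ae_hull_of_ae_interior hK hp] with x hx
    rw [hx]
  constructor
  · rw [h1, integrable_indicator_iff hm, IntegrableOn, T.restrict_hull hK, integrable_congr h2]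
    exact (hF.mul (continuous_mvPolynomial_eval p)).continuousOn.integrableOn_compact
      (isCompact_hull K)
  · rw [h1, integral_indicator hm, T.restrict_hull hK, integral_congr_ae h2]

namespace Numbering

theorem localPoly_eq (σ : T.Numbering) {q : L2 Ω} {K : Finset Plane} (hK : K ∈ T.triangles)
    {p : MvPolynomial (Fin 2) ℝ}
    (hp : ∀ᵐ x ∂Ω.measure, x ∈ interior (hull K) → q x = MvPolynomial.eval (fun i => x i) p) :
    localPoly q K = p := by
  have hex : ∃ p : MvPolynomial (Fin 2) ℝ,
      ∀ᵐ x ∂Ω.measure, x ∈ interior (hull K) → q x = MvPolynomial.eval (fun i => x i) p := ⟨p, hp⟩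
  have hs := hex.choose_spec
  rw [localPoly, dif_pos hex]
  refine mvPolynomial_eq_of_ae (isOpen_interior.inter Ω.isOpen) (σ.interior_inter_nonempty hK) ?_
  filter_upwards [(ae_restrict_iff' Ω.isOpen.measurableSet).1 hp,
    (ae_restrict_iff' Ω.isOpen.measurableSet).1 hs] with x h1 h2 hx
  rw [← h1 hx.2 hx.1, ← h2 hx.2 hx.1]

theorem localPoly_spec (σ : T.Numbering) {n : ℕ} {q : L2 Ω} (hq : q ∈ T.brokenPoly n)
    {K : Finset Plane} (hK : K ∈ T.triangles) :
    (localPoly q K).totalDegree ≤ n ∧ ∀ᵐ x ∂Ω.measure, x ∈ interior (hull K) →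
      q x = MvPolynomial.eval (fun i => x i) (localPoly q K) := by
  obtain ⟨p, hp, hp'⟩ := hq K hK
  rw [σ.localPoly_eq hK hp']
  exact ⟨hp, hp'⟩

end Numbering

end Triangulation

theorem coeFn_constL2 (Ω : Domain) (c : ℝ) : constL2 Ω c =ᵐ[Ω.measure] fun _ => c :=
  Lp.coeFn_const 2 Ω.measure c

theorem inner_constL2 {Ω : Domain} (c : ℝ) (q : L2 Ω) :
    inner ℝ (constL2 Ω c) q = c * ∫ x in Ω.carrier, q x := by
  rw [L2.inner_def, ← integral_const_mul]
  refine integral_congr_ae ?_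
  filter_upwards [coeFn_constL2 Ω c] with x hx
  rw [hx]
  simp [mul_comm]

theorem constL2_eq_smul (Ω : Domain) (c : ℝ) : constL2 Ω c = c • constL2 Ω 1 := by
  refine Lp.ext ?_
  filter_upwards [coeFn_constL2 Ω c, coeFn_constL2 Ω 1, Lp.coeFn_smul c (constL2 Ω 1)] with
    x h1 h2 h3
  rw [h1, h3, Pi.smul_apply, h2, smul_eq_mul, mul_one]

theorem inner_one {Ω : Domain} (q : L2 Ω) :
    inner ℝ (constL2 Ω 1) q = ∫ x in Ω.carrier, q x := by
  rw [inner_constL2, one_mul]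

theorem Domain.volume_pos (Ω : Domain) : 0 < volume.real Ω.carrier :=
  ENNReal.toReal_pos (Ω.isOpen.measure_pos volume Ω.isConnected.nonempty).ne'
    Ω.isBounded.measure_lt_top.ne

theorem integral_constL2_one (Ω : Domain) :
    ∫ x in Ω.carrier, constL2 Ω 1 x = volume.real Ω.carrier := by
  rw [integral_congr_ae (coeFn_constL2 Ω 1)]
  simp

theorem mean_eq {Ω : Domain} (q : L2 Ω) :
    mean q = (volume.real Ω.carrier)⁻¹ * inner ℝ (constL2 Ω 1) q := by
  rw [inner_one, mean, setAverage_eq, smul_eq_mul]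

theorem mvz_eq {Ω : Domain} (q : L2 Ω) : mvz q = q - mean q • constL2 Ω 1 := by
  rw [mvz, constL2_eq_smul]

theorem inner_one_mvz {Ω : Domain} (q : L2 Ω) : inner ℝ (constL2 Ω 1) (mvz q) = 0 := by
  have h := Ω.volume_pos.ne'
  rw [mvz_eq, inner_sub_right, inner_smul_right, mean_eq, inner_one (constL2 Ω 1),
    integral_constL2_one]
  field_simp
  ring

/-! ### The critical functions -/

/-- The barycentric coordinate `bary z a b` as a polynomial. -/
def baryPoly (z a b : Plane) : MvPolynomial (Fin 2) ℝ :=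
  MvPolynomial.C (1 / cross (a - z) (b - z)) *
    (MvPolynomial.C (cross a b) -
      (MvPolynomial.C (a 0) * MvPolynomial.X 1 - MvPolynomial.C (a 1) * MvPolynomial.X 0) -
      (MvPolynomial.C (b 1) * MvPolynomial.X 0 - MvPolynomial.C (b 0) * MvPolynomial.X 1))

theorem eval_baryPoly (z a b x : Plane) :
    MvPolynomial.eval (fun i => x i) (baryPoly z a b) = bary z a b x := by
  simp only [baryPoly, bary, cross, PiLp.sub_apply, map_mul, map_sub, MvPolynomial.eval_C,
    MvPolynomial.eval_X]
  ring

theorem totalDegree_baryPoly_le (z a b : Plane) : (baryPoly z a b).totalDegree ≤ 1 := by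
  have h : ∀ (c : ℝ) (i : Fin 2),
      (MvPolynomial.C c * MvPolynomial.X i : MvPolynomial (Fin 2) ℝ).totalDegree ≤ 1 := fun c i =>
    (MvPolynomial.totalDegree_mul _ _).trans (by simp)
  refine (MvPolynomial.totalDegree_mul _ _).trans ?_
  rw [MvPolynomial.totalDegree_C, zero_add]
  refine (MvPolynomial.totalDegree_sub _ _).trans (max_le ?_ ?_)
  · refine (MvPolynomial.totalDegree_sub _ _).trans (max_le (by simp) ?_)
    exact (MvPolynomial.totalDegree_sub _ _).trans (max_le (h _ _) (h _ _))
  · exact (MvPolynomial.totalDegree_sub _ _).trans (max_le (h _ _) (h _ _))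

theorem totalDegree_aeval_le {σ : Type*} (J : Polynomial ℝ) {m : MvPolynomial σ ℝ}
    (hm : m.totalDegree ≤ 1) : (Polynomial.aeval m J).totalDegree ≤ J.natDegree := by
  rw [Polynomial.aeval_eq_sum_range]
  refine MvPolynomial.totalDegree_finsetSum_le fun i hi => ?_
  refine (MvPolynomial.totalDegree_smul_le _ _).trans ((MvPolynomial.totalDegree_pow _ _).trans ?_)
  have := Finset.mem_range.1 hi
  nlinarith

/-- The polynomial `P_n^{(0,2)}(1 - 2 λ_z)` on the triangle with vertices `z, a, b`. -/
def jacobiPoly (n : ℕ) (z a b : Plane) : MvPolynomial (Fin 2) ℝ :=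
  Polynomial.aeval (1 - 2 * baryPoly z a b) (jacobi 0 2 n)

theorem eval_jacobiPoly (n : ℕ) (z a b x : Plane) :
    MvPolynomial.eval (fun i => x i) (jacobiPoly n z a b)
      = (jacobi 0 2 n).eval (1 - 2 * bary z a b x) := by
  rw [jacobiPoly, ← MvPolynomial.coe_aeval_eq_eval, RingHom.coe_coe,
    ← Polynomial.aeval_algHom_apply, ← Polynomial.coe_aeval_eq_eval]
  simp only [map_sub, map_one, map_mul, map_ofNat]
  rw [← eval_baryPoly, ← MvPolynomial.coe_aeval_eq_eval, RingHom.coe_coe]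

theorem totalDegree_jacobiPoly_le (n : ℕ) (z a b : Plane) :
    (jacobiPoly n z a b).totalDegree ≤ n := by
  refine (totalDegree_aeval_le _ ?_).trans (natDegree_jacobi_le n)
  refine (MvPolynomial.totalDegree_sub _ _).trans (max_le (by simp) ?_)
  refine (MvPolynomial.totalDegree_mul _ _).trans ?_
  have h2 : (2 : MvPolynomial (Fin 2) ℝ).totalDegree = 0 := by
    rw [show (2 : MvPolynomial (Fin 2) ℝ) = MvPolynomial.C 2 by rw [map_ofNat],
      MvPolynomial.totalDegree_C]
  rw [h2, zero_add]
  exact totalDegree_baryPoly_le z a b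

theorem bary_self {z a b : Plane} (hD : cross (a - z) (b - z) ≠ 0) : bary z a b z = 1 :=
  div_self hD

theorem bary_left (z a b : Plane) : bary z a b a = 0 := by simp [bary, cross]

theorem bary_right (z a b : Plane) : bary z a b b = 0 := by simp [bary, cross]

namespace Triangulation

variable {Ω : Domain} {T : Triangulation Ω}

namespace Numbering

variable (σ : T.Numbering)

/-- The sign and scaling of `b_{n,z}` on the triangle with number `ℓ + 1`. -/
def critCoeff (n : ℕ) (z : Plane) (ℓ : ℕ) : ℝ :=
  (-1) ^ (n + (ℓ + 1)) / volume.real (hull (σ.tri z ℓ))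

theorem critCoeff_ne_zero (n : ℕ) {z : Plane} (hz : z ∈ T.vertices) {ℓ : ℕ} (hℓ : ℓ < T.N z) :
    σ.critCoeff n z ℓ ≠ 0 :=
  div_ne_zero (pow_ne_zero _ (by norm_num)) (σ.volume_hull_pos (σ.tri_mem hz hℓ)).ne'

theorem ae_b_eq (n : ℕ) {z : Plane} (hz : z ∈ T.vertices) {ℓ : ℕ} (hℓ : ℓ < T.N z) :
    ∀ᵐ x ∂Ω.measure, x ∈ interior (hull (σ.tri z ℓ)) → σ.b n z x =
      MvPolynomial.eval (fun i => x i)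
        (σ.critCoeff n z ℓ • jacobiPoly n z (σ.pt z ℓ) (σ.pt z (ℓ + 1))) := by
  have h1 : ∀ᵐ x ∂Ω.measure, ∀ m ∈ (Finset.range (T.N z)).erase ℓ,
      x ∈ hull (σ.tri z ℓ) → x ∉ hull (σ.tri z m) := by
    refine (Finset.eventually_all _).2 fun m hm => ae_restrict_of_ae ?_
    obtain ⟨hmℓ, hm⟩ := Finset.mem_erase.1 hm
    refine ae_notMem_hull (σ.tri_mem hz hℓ) (σ.tri_mem hz (Finset.mem_range.1 hm)) fun h => hmℓ ?_
    exact (σ.tri_injOn hz (Finset.mem_coe.2 (Finset.mem_range.2 hℓ)) (Finset.mem_coe.2 hm) h).symm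
  filter_upwards [h1, (σ.memLp_critFun n z).coeFn_toLp] with x h1 h2 hx
  rw [b, h2, critFun, Finset.sum_eq_single_of_mem ℓ (Finset.mem_range.2 hℓ), MvPolynomial.smul_eval,
    eval_jacobiPoly, Set.indicator_of_mem (interior_subset hx), critCoeff]
  intro m hm hmℓ
  exact Set.indicator_of_notMem (h1 m (Finset.mem_erase.2 ⟨hmℓ, hm⟩) (interior_subset hx)) _

theorem ae_b_eq_zero (n : ℕ) {z : Plane} (hz : z ∈ T.vertices) {K : Finset Plane}
    (hK : K ∈ T.triangles) (hzK : K ∉ T.patch z) :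
    ∀ᵐ x ∂Ω.measure, x ∈ interior (hull K) → σ.b n z x =
      MvPolynomial.eval (fun i => x i) (0 : MvPolynomial (Fin 2) ℝ) := by
  have h1 : ∀ᵐ x ∂Ω.measure, ∀ m ∈ Finset.range (T.N z), x ∈ hull K → x ∉ hull (σ.tri z m) := by
    refine (Finset.eventually_all _).2 fun m hm => ae_restrict_of_ae ?_
    refine ae_notMem_hull hK (σ.tri_mem hz (Finset.mem_range.1 hm)) ?_
    rintro rfl
    exact hzK (σ.tri_mem_patch hz (Finset.mem_range.1 hm))
  filter_upwards [h1, (σ.memLp_critFun n z).coeFn_toLp] with x h1 h2 hx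
  rw [b, h2, critFun, map_zero]
  exact Finset.sum_eq_zero fun m hm =>
    Set.indicator_of_notMem (h1 m hm (interior_subset hx)) _

theorem b_mem_brokenPoly (n : ℕ) {z : Plane} (hz : z ∈ T.vertices) :
    σ.b n z ∈ T.brokenPoly n := by
  intro K hK
  by_cases h : K ∈ T.patch z
  · obtain ⟨ℓ, hℓ, rfl⟩ := σ.exists_tri_eq hz h
    exact ⟨_, (MvPolynomial.totalDegree_smul_le _ _).trans (totalDegree_jacobiPoly_le n _ _ _),
      σ.ae_b_eq n hz hℓ⟩
  · exact ⟨0, by simp, σ.ae_b_eq_zero n hz hK h⟩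

end Numbering

theorem constL2_mem_brokenPoly (T : Triangulation Ω) (n : ℕ) (c : ℝ) :
    constL2 Ω c ∈ T.brokenPoly n := by
  intro K _
  refine ⟨MvPolynomial.C c, by simp, ?_⟩
  filter_upwards [coeFn_constL2 Ω c] with x hx _
  rw [hx, MvPolynomial.eval_C]

namespace Numbering

variable (σ : T.Numbering)

/-- The critical function `b_{n,z}` represents the functional `A_{𝒯,z}` on `ℙ_n(𝒯)`, up to a
positive factor. -/
theorem inner_b (n : ℕ) {z : Plane} (hz : z ∈ T.vertices) {q : L2 Ω} (hq : q ∈ T.brokenPoly n) :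
    inner ℝ (σ.b n z) q = ((n + 2).choose 2 : ℝ)⁻¹ * σ.altSum z q := by
  let F : ℕ → Plane → ℝ := fun ℓ y => (-1) ^ (n + (ℓ + 1)) / volume.real (hull (σ.tri z ℓ)) *
        (jacobi 0 2 n).eval (1 - 2 * bary z (σ.pt z ℓ) (σ.pt z (ℓ + 1)) y)
  have hF : ∀ ℓ, Continuous (F ℓ) := fun ℓ => continuous_const.mul (continuous_jacobi_bary _ _ _ _)
  have h1 : inner ℝ (σ.b n z) q = ∫ x, ∑ ℓ ∈ Finset.range (T.N z),
      (hull (σ.tri z ℓ)).indicator (F ℓ) x * q x ∂Ω.measure := by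
    rw [L2.inner_def]
    refine integral_congr_ae ?_
    filter_upwards [(σ.memLp_critFun n z).coeFn_toLp] with x hx
    rw [b, hx, critFun, ← Finset.sum_mul]
    simp only [RCLike.inner_apply, conj_trivial]
    rw [mul_comm]
  have h2 := fun (ℓ : ℕ) (hℓ : ℓ ∈ Finset.range (T.N z)) =>
    T.integral_indicator_hull_mul (σ.tri_mem hz (Finset.mem_range.1 hℓ)) (hF ℓ)
      (σ.localPoly_spec hq (σ.tri_mem hz (Finset.mem_range.1 hℓ))).2
  rw [h1, integral_finsetSum _ fun ℓ hℓ => (h2 ℓ hℓ).1, altSum, Finset.mul_sum]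
  refine Finset.sum_congr rfl fun ℓ hℓ => ?_
  have hℓ' := Finset.mem_range.1 hℓ
  have h3 := setIntegral_jacobi_bary (σ.cross_ne_zero hz hℓ') n _
    (σ.localPoly_spec hq (σ.tri_mem hz hℓ')).1
  have hv : volume.real (hull (σ.tri z ℓ)) ≠ 0 := (σ.volume_hull_pos (σ.tri_mem hz hℓ')).ne'
  have hs : ((-1 : ℝ)) ^ n * (-1) ^ n = 1 := by rw [← mul_pow]; simp
  rw [(h2 ℓ hℓ).2]
  simp only [F, mul_assoc]
  rw [integral_const_mul]
  simp only [tri] at h3 hv ⊢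
  rw [h3, pow_add]
  set v := volume.real (hull {z, σ.pt z ℓ, σ.pt z (ℓ + 1)})
  set e := MvPolynomial.eval (fun i => z i) (localPoly q {z, σ.pt z ℓ, σ.pt z (ℓ + 1)})
  calc _ = ((-1) ^ n * (-1) ^ n) * (v / v) *
        (((n + 2).choose 2 : ℝ)⁻¹ * ((-1) ^ (ℓ + 1) * e)) := by ring
    _ = _ := by rw [hs, div_self hv, one_mul, one_mul]

theorem altSum_constL2 {z : Plane} (hz : z ∈ T.vertices) :
    σ.altSum z (constL2 Ω 1) = ∑ ℓ ∈ Finset.range (T.N z), (-1) ^ (ℓ + 1) := by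
  refine Finset.sum_congr rfl fun ℓ hℓ => ?_
  rw [σ.localPoly_eq (p := 1) (σ.tri_mem hz (Finset.mem_range.1 hℓ))]
  · simp
  · filter_upwards [coeFn_constL2 Ω 1] with x hx _
    rw [hx, map_one]

theorem inner_b_one_of_even (n : ℕ) {z : Plane} (hz : z ∈ T.vertices) (he : Even (T.N z)) :
    inner ℝ (σ.b n z) (constL2 Ω 1) = 0 := by
  rw [σ.inner_b n hz (T.constL2_mem_brokenPoly n 1), σ.altSum_constL2 hz]
  simp only [pow_succ, ← Finset.sum_mul]
  rw [neg_one_geom_sum, if_pos he]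
  simp

theorem inner_b_eq_zero (n : ℕ) {y z : Plane} (hy : y ∈ T.vertices) (hz : z ∈ T.vertices)
    (h : ∀ K ∈ T.patch y, K ∉ T.patch z) : inner ℝ (σ.b n y) (σ.b n z) = 0 := by
  rw [σ.inner_b n hy (σ.b_mem_brokenPoly n hz), altSum, Finset.sum_eq_zero, mul_zero]
  intro ℓ hℓ
  have hℓ' := Finset.mem_range.1 hℓ
  rw [σ.localPoly_eq (σ.tri_mem hy hℓ') (σ.ae_b_eq_zero n hz (σ.tri_mem hy hℓ')
    (h _ (σ.tri_mem_patch hy hℓ'))), map_zero, mul_zero]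

/-- The values at the vertices of `K` and the integral over `K` of the polynomial `b_{n,z}|_K`. -/
theorem exists_coeff_b (n : ℕ) {z : Plane} (hz : z ∈ T.vertices) {K : Finset Plane}
    (hK : K ∈ T.triangles) :
    ∃ (s : ℝ) (p : MvPolynomial (Fin 2) ℝ), (z ∈ K → s ≠ 0) ∧ (z ∉ K → s = 0) ∧
      (∀ᵐ x ∂Ω.measure, x ∈ interior (hull K) →
        σ.b n z x = MvPolynomial.eval (fun i => x i) p) ∧
      (∀ w ∈ K, MvPolynomial.eval (fun i => w i) p
        = s + s * ((-1) ^ n * ((n + 2).choose 2 : ℝ) - 1) * if w = z then 1 else 0) ∧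
      ∫ x in hull K, MvPolynomial.eval (fun i => x i) p
        = volume.real (hull K) * (s * ((-1) ^ n / ((n + 2).choose 2 : ℝ))) := by
  by_cases h : K ∈ T.patch z
  · obtain ⟨ℓ, hℓ, rfl⟩ := σ.exists_tri_eq hz h
    have hc := σ.critCoeff_ne_zero n hz hℓ
    have hD := σ.cross_ne_zero hz hℓ
    refine ⟨_, _, fun _ => hc, fun h' => absurd (σ.mem_of_mem_patch hz h) h',
      σ.ae_b_eq n hz hℓ, ?_, ?_⟩
    · intro w hw
      rw [MvPolynomial.smul_eval, eval_jacobiPoly]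
      by_cases hwz : w = z
      · subst hwz
        rw [bary_self hD, if_pos rfl, show (1 - 2 * 1 : ℝ) = -1 by norm_num, jacobi_eval_neg_one]
        ring
      · have h0 : bary z (σ.pt z ℓ) (σ.pt z (ℓ + 1)) w = 0 := by
          simp only [tri, Finset.mem_insert, Finset.mem_singleton] at hw
          rcases hw with rfl | rfl | rfl
          · exact absurd rfl hwz
          · exact bary_left _ _ _
          · exact bary_right _ _ _
        rw [h0, if_neg hwz, mul_zero, sub_zero, jacobi_eval_one]
        ring
    · have h3 := setIntegral_jacobi_bary hD n 1 (by simp)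
      simp only [map_one, mul_one] at h3
      simp only [MvPolynomial.smul_eval, eval_jacobiPoly]
      rw [integral_const_mul, tri, h3]
      ring
  · have hzK : z ∉ K := fun h' => h ((σ.mem_patch_iff hz).2 ⟨hK, h'⟩)
    exact ⟨0, 0, fun h' => absurd h' hzK, fun _ => rfl, σ.ae_b_eq_zero n hz hK h,
      fun w _ => by simp, by simp⟩

theorem ae_sum_eq {ι : Type*} (C : Finset ι) {K : Finset Plane} (q : ι → L2 Ω)
    (p : ι → MvPolynomial (Fin 2) ℝ) (a : ι → ℝ)
    (h : ∀ i ∈ C, ∀ᵐ x ∂Ω.measure, x ∈ interior (hull K) →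
      q i x = MvPolynomial.eval (fun i => x i) (p i)) :
    ∀ᵐ x ∂Ω.measure, x ∈ interior (hull K) →
      (∑ i ∈ C, a i • q i : L2 Ω) x = MvPolynomial.eval (fun i => x i) (∑ i ∈ C, a i • p i) := by
  induction C using Finset.induction_on with
  | empty =>
    filter_upwards [Lp.coeFn_zero ℝ 2 Ω.measure] with x h _
    rw [Finset.sum_empty, Finset.sum_empty, map_zero]
    exact h
  | insert i C hi ih =>
    rw [Finset.sum_insert hi, Finset.sum_insert hi]
    filter_upwards [ih fun j hj => h j (Finset.mem_insert_of_mem hj),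
      h i (Finset.mem_insert_self i C), Lp.coeFn_add (a i • q i) (∑ i ∈ C, a i • q i),
      Lp.coeFn_smul (a i) (q i)] with x h1 h2 h3 h4 hx
    rw [h3, Pi.add_apply, h1 hx, h4, Pi.smul_apply, h2 hx, map_add, MvPolynomial.smul_eval,
      smul_eq_mul]

/-- A combination of critical functions that is constant is trivial. On a triangle `K` write the
combination as `∑ β_w P(1 - 2 λ_w)`, with `w` running through the vertices of `K`, and let
`ε = P(-1)`. The values at the vertices and the mean over `K` give `S + β_w (ε - 1) = d` and
`S = ε d` for `S = ∑ β_w`, hence `(ε - 1) (ε + 3) d = 0`. -/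
theorem coeff_eq_zero_of_sum_b_eq_const {n : ℕ} (hn : 2 ≤ n) {C : Finset Plane}
    (hC : C ⊆ T.vertices) (α : Plane → ℝ) (d : ℝ)
    (h : ∑ z ∈ C, α z • σ.b n z = constL2 Ω d) : ∀ z ∈ C, α z = 0 := by
  intro z₀ hz₀
  obtain ⟨K, hK, hz₀K⟩ := mem_vertices.1 (hC hz₀)
  have hex : ∀ z, ∃ (s : ℝ) (p : MvPolynomial (Fin 2) ℝ), z ∈ C → (z ∈ K → s ≠ 0) ∧
      (z ∉ K → s = 0) ∧
      (∀ᵐ x ∂Ω.measure, x ∈ interior (hull K) →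
        σ.b n z x = MvPolynomial.eval (fun i => x i) p) ∧
      (∀ w ∈ K, MvPolynomial.eval (fun i => w i) p
        = s + s * ((-1) ^ n * ((n + 2).choose 2 : ℝ) - 1) * if w = z then 1 else 0) ∧
      ∫ x in hull K, MvPolynomial.eval (fun i => x i) p
        = volume.real (hull K) * (s * ((-1) ^ n / ((n + 2).choose 2 : ℝ))) := by
    intro z
    by_cases hz : z ∈ C
    · obtain ⟨s, p, hsp⟩ := σ.exists_coeff_b n (hC hz) hK
      exact ⟨s, p, fun _ => hsp⟩
    · exact ⟨0, 0, fun h => absurd h hz⟩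
  choose s p hsp using hex
  have hpoly : ∑ z ∈ C, α z • p z = MvPolynomial.C d := by
    rw [← σ.localPoly_eq (q := ∑ z ∈ C, α z • σ.b n z) hK
      (ae_sum_eq C (fun z => σ.b n z) p α fun z hz => (hsp z hz).2.2.1), h]
    refine σ.localPoly_eq hK ?_
    filter_upwards [coeFn_constL2 Ω d] with x hx _
    rw [hx, MvPolynomial.eval_C]
  set B : ℝ := ((n + 2).choose 2 : ℝ) with hB
  set ε : ℝ := (-1) ^ n * B with hε
  set S : ℝ := ∑ z ∈ C, α z * s z with hS
  have hB4 : 4 ≤ B := by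
    have : (4 + 0).choose 2 ≤ (n + 2).choose 2 := Nat.choose_le_choose 2 (by omega)
    rw [hB]
    exact_mod_cast (show 4 ≤ (4 + 0).choose 2 by decide).trans this
  have hεB : ε = B ∨ ε = -B := by
    rcases neg_one_pow_eq_or ℝ n with h | h <;> rw [hε, h] <;> simp
  have hval : ∀ w ∈ K, S + (if w ∈ C then α w * s w else 0) * (ε - 1) = d := by
    intro w hw
    have h1 := congrArg (MvPolynomial.eval (fun i => w i)) hpoly
    rw [map_sum, MvPolynomial.eval_C] at h1
    rw [← h1, hS, ← Finset.sum_ite_eq C w fun z => α z * s z, Finset.sum_mul,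
      ← Finset.sum_add_distrib]
    refine Finset.sum_congr rfl fun z hz => ?_
    rw [MvPolynomial.smul_eval, (hsp z hz).2.2.2.1 w hw]
    split_ifs <;> ring
  have hint : S = ε * d := by
    have h1 : ∫ x in hull K, MvPolynomial.eval (fun i => x i) (∑ z ∈ C, α z • p z)
        = ∑ z ∈ C, α z * ∫ x in hull K, MvPolynomial.eval (fun i => x i) (p z) := by
      simp only [map_sum, MvPolynomial.smul_eval]
      rw [integral_finsetSum]
      · simp only [integral_const_mul]
      · exact fun z _ => ((continuous_mvPolynomial_eval (p z)).continuousOn.integrableOn_compact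
          (isCompact_hull K)).const_mul _
    have h2 : ∑ z ∈ C, α z * ∫ x in hull K, MvPolynomial.eval (fun i => x i) (p z)
        = volume.real (hull K) * ((-1) ^ n / B) * S := by
      rw [hS, Finset.mul_sum]
      refine Finset.sum_congr rfl fun z hz => ?_
      rw [(hsp z hz).2.2.2.2]
      ring
    rw [hpoly, h2] at h1
    simp only [MvPolynomial.eval_C, setIntegral_const, smul_eq_mul] at h1
    have hv := (σ.volume_hull_pos hK).ne'
    have hB0 : B ≠ 0 := by positivity
    have h3 : (-1) ^ n * S = B * d := by
      rw [mul_assoc] at h1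
      have := mul_left_cancel₀ hv h1
      field_simp at this
      linarith
    have hs : ((-1 : ℝ)) ^ n * (-1) ^ n = 1 := by rw [← mul_pow]; simp
    rw [hε, mul_assoc, ← h3, ← mul_assoc, hs, one_mul]
  have hsum : ∑ w ∈ K, (if w ∈ C then α w * s w else 0) = S := by
    rw [Finset.sum_ite_mem, Finset.inter_comm]
    refine Finset.sum_subset Finset.inter_subset_left fun z hz hz' => ?_
    rw [(hsp z hz).2.1 fun h' => hz' (Finset.mem_inter.2 ⟨hz, h'⟩), mul_zero]
  have h3 : 3 * S + S * (ε - 1) = 3 * d := by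
    have := Finset.sum_congr rfl hval
    rw [Finset.sum_add_distrib, ← Finset.sum_mul, hsum] at this
    simpa [T.card_eq K hK] using this
  have hd : d = 0 := by
    have h4 : (ε - 1) * (ε + 3) * d = 0 := by rw [hint] at h3; linarith
    have h5 : (ε - 1) * (ε + 3) ≠ 0 := by
      rcases hεB with h | h <;> rw [h] <;> refine mul_ne_zero ?_ ?_ <;> intro h' <;> linarith
    exact (mul_eq_zero.1 h4).resolve_left h5
  have h6 := hval z₀ hz₀K
  rw [if_pos hz₀, hint, hd, mul_zero, zero_add] at h6
  have h7 : ε - 1 ≠ 0 := by rcases hεB with h | h <;> rw [h] <;> intro h' <;> linarith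
  exact ((mul_eq_zero.1 ((mul_eq_zero.1 h6).resolve_right h7))).resolve_right
    ((hsp z₀ hz₀).1 hz₀K)

end Numbering

end Triangulation

/-! ### Angles at a critical vertex -/

/-- The unit vector with polar angle `a`. -/
def dir (a : ℝ) : Plane := !₂[Real.cos a, Real.sin a]

theorem cross_dir (a b : ℝ) : cross (dir a) (dir b) = Real.sin (b - a) := by
  simp [cross, dir, Real.sin_sub]
  ring

theorem cross_smul_left (c : ℝ) (u v : Plane) : cross (c • u) v = c * cross u v := by
  simp only [cross, PiLp.smul_apply, smul_eq_mul]; ring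

theorem cross_smul_right (c : ℝ) (u v : Plane) : cross u (c • v) = c * cross u v := by
  simp only [cross, PiLp.smul_apply, smul_eq_mul]; ring

theorem cross_add_right (u v w : Plane) : cross u (v + w) = cross u v + cross u w := by
  simp only [cross, PiLp.add_apply]; ring

theorem cross_self (u : Plane) : cross u u = 0 := by simp only [cross]; ring

theorem inner_plane (u v : Plane) : inner ℝ u v = u 0 * v 0 + u 1 * v 1 := by
  simp [PiLp.inner_apply, Fin.sum_univ_two, mul_comm]

theorem exists_eq_norm_smul_dir (u : Plane) : ∃ a, u = ‖u‖ • dir a := by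
  have hn : ‖(⟨u 0, u 1⟩ : ℂ)‖ = ‖u‖ := by
    rw [Complex.norm_def, EuclideanSpace.norm_eq, Complex.normSq_mk, Fin.sum_univ_two]
    simp [sq]
  refine ⟨Complex.arg ⟨u 0, u 1⟩, ?_⟩
  ext i
  fin_cases i
  · simpa [dir, hn] using (Complex.norm_mul_cos_arg ⟨u 0, u 1⟩).symm
  · simpa [dir, hn] using (Complex.norm_mul_sin_arg ⟨u 0, u 1⟩).symm

theorem sin_angle_mul_norm {u v : Plane} (h : 0 < cross u v) :
    Real.sin (InnerProductGeometry.angle u v) * (‖u‖ * ‖v‖) = cross u v := by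
  rw [InnerProductGeometry.sin_angle_mul_norm_mul_norm, ← Real.sqrt_sq h.le]
  congr 1
  simp only [inner_plane, cross]
  ring

/-- A counterclockwise rotation adds the unoriented angle to the polar angle. -/
theorem eq_norm_smul_dir_add_angle {u v : Plane} {a : ℝ} (hu : u = ‖u‖ • dir a)
    (h : 0 < cross u v) : v = ‖v‖ • dir (a + InnerProductGeometry.angle u v) := by
  have hs := sin_angle_mul_norm h
  have hc := InnerProductGeometry.cos_angle_mul_norm_mul_norm u v
  set θ := InnerProductGeometry.angle u v
  have hu0 : ‖u‖ ≠ 0 := by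
    intro h0
    rw [norm_eq_zero] at h0
    subst h0
    simp [cross] at h
  have h0 : u 0 = ‖u‖ * Real.cos a := by simpa [dir] using congrArg (fun x : Plane => x 0) hu
  have h1 : u 1 = ‖u‖ * Real.sin a := by simpa [dir] using congrArg (fun x : Plane => x 1) hu
  rw [inner_plane, h0, h1] at hc
  rw [cross, h0, h1] at hs
  have hc' : Real.cos a * v 0 + Real.sin a * v 1 = ‖v‖ * Real.cos θ :=
    mul_left_cancel₀ hu0 (by linear_combination -hc)
  have hs' : Real.cos a * v 1 - Real.sin a * v 0 = ‖v‖ * Real.sin θ :=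
    mul_left_cancel₀ hu0 (by linear_combination -hs)
  have ha := Real.cos_sq_add_sin_sq a
  ext i
  fin_cases i
  · simp only [dir, Fin.zero_eta, PiLp.smul_apply, smul_eq_mul, Real.cos_add]
    simp
    linear_combination Real.cos a * hc' - Real.sin a * hs' - v 0 * ha
  · simp only [dir, Fin.mk_one, PiLp.smul_apply, smul_eq_mul, Real.sin_add]
    simp
    linear_combination Real.sin a * hc' + Real.cos a * hs' - v 1 * ha

/-- The ball inscribed in a triangle fits between a side and the parallel through the opposite
vertex. -/
theorem mul_norm_le_cross_of_closedBall_subset {z a b c : Plane} {r : ℝ} (hr : 0 ≤ r)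
    (hu : a - z ≠ 0) (hD : 0 < cross (a - z) (b - z))
    (hball : Metric.closedBall c r ⊆ hull {z, a, b}) :
    2 * r * ‖a - z‖ ≤ cross (a - z) (b - z) := by
  have hstrip : ∀ x ∈ hull {z, a, b}, 0 ≤ cross (a - z) (x - z) ∧
      cross (a - z) (x - z) ≤ cross (a - z) (b - z) := by
    intro x hx
    obtain ⟨s, t, hs, ht, hst, rfl⟩ := mem_hull_triple.1 hx
    have : cross (a - z) (z + s • (a - z) + t • (b - z) - z) = t * cross (a - z) (b - z) := by
      rw [show z + s • (a - z) + t • (b - z) - z = s • (a - z) + t • (b - z) by abel,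
        cross_add_right, cross_smul_right, cross_smul_right, cross_self]
      ring
    rw [this]
    exact ⟨by positivity, by nlinarith⟩
  set u := a - z with hudef
  have hu0 : 0 < ‖u‖ := norm_pos_iff.2 hu
  let m : Plane := !₂[-u 1, u 0]
  have hsq : ‖u‖ ^ 2 = u 0 * u 0 + u 1 * u 1 := by rw [← real_inner_self_eq_norm_sq, inner_plane]
  have hm : ‖m‖ = ‖u‖ := by
    rw [← sq_eq_sq₀ (norm_nonneg _) (norm_nonneg _), hsq, ← real_inner_self_eq_norm_sq, inner_plane]
    simp [m]
    ring
  have hum : cross u m = ‖u‖ ^ 2 := by rw [hsq]; simp [cross, m]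
  have hmem : ∀ ρ : ℝ, |ρ| = r → c + (ρ / ‖u‖) • m ∈ hull {z, a, b} := by
    intro ρ hρ
    refine hball ?_
    rw [Metric.mem_closedBall, dist_eq_norm, add_sub_cancel_left, norm_smul, hm, Real.norm_eq_abs,
      abs_div, abs_norm, hρ, div_mul_cancel₀ _ hu0.ne']
  have h1 := (hstrip _ (hmem r (abs_of_nonneg hr))).2
  have h2 := (hstrip _ (hmem (-r) (by rw [abs_neg, abs_of_nonneg hr]))).1
  rw [add_sub_right_comm, cross_add_right, cross_smul_right, hum] at h1 h2
  have h3 : ∀ ρ : ℝ, ρ / ‖u‖ * ‖u‖ ^ 2 = ρ * ‖u‖ := fun ρ => by field_simp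
  rw [h3] at h1 h2
  linarith

theorem inDiam_pos_and_mul_norm_le {z a b : Plane} (hD : 0 < cross (a - z) (b - z))
    (hint : (interior (hull {z, a, b})).Nonempty) :
    0 < inDiam {z, a, b} ∧ inDiam {z, a, b} * ‖a - z‖ ≤ cross (a - z) (b - z) := by
  have hu : a - z ≠ 0 := by
    intro h0
    rw [h0] at hD
    simp [cross] at hD
  have hu0 : 0 < ‖a - z‖ := norm_pos_iff.2 hu
  have hub : ∀ d ∈ {d : ℝ | ∃ (c : Plane) (r : ℝ), 0 ≤ r ∧ d = 2 * r ∧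
      Metric.closedBall c r ⊆ hull {z, a, b}}, d ≤ cross (a - z) (b - z) / ‖a - z‖ := by
    rintro d ⟨c, r, hr, rfl, hball⟩
    rw [le_div_iff₀ hu0]
    exact mul_norm_le_cross_of_closedBall_subset hr hu hD hball
  obtain ⟨x, hx⟩ := hint
  obtain ⟨r, hr, hball⟩ := Metric.nhds_basis_closedBall.mem_iff.1 (mem_interior_iff_mem_nhds.1 hx)
  have hmem : 2 * r ∈ {d : ℝ | ∃ (c : Plane) (r : ℝ), 0 ≤ r ∧ d = 2 * r ∧
      Metric.closedBall c r ⊆ hull {z, a, b}} := ⟨x, r, hr.le, rfl, hball⟩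
  refine ⟨(by positivity : 0 < 2 * r).trans_le (le_csSup ⟨_, hub⟩ hmem), ?_⟩
  rw [← le_div_iff₀ hu0]
  exact csSup_le ⟨_, hmem⟩ hub

/-- If `0 < δ ≤ sin α, sin β` and `|sin (α + β)| < δ / 5`, then `α + β` is close to `π`. -/
theorem abs_add_sub_pi_lt {α β δ : ℝ} (hδ : 0 < δ) (hα : 0 ≤ α) (hα' : α ≤ Real.pi)
    (hβ : 0 ≤ β) (hβ' : β ≤ Real.pi) (h1 : δ ≤ Real.sin α) (h2 : δ ≤ Real.sin β)
    (h : |Real.sin (α + β)| < δ / 5) : |α + β - Real.pi| < δ / 3 := by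
  have e1 : δ ≤ α := h1.trans (Real.sin_le hα)
  have e2 : δ ≤ β := h2.trans (Real.sin_le hβ)
  have e3 : δ ≤ Real.pi - α := by
    rw [← Real.sin_pi_sub] at h1; exact h1.trans (Real.sin_le (by linarith))
  have e4 : δ ≤ Real.pi - β := by
    rw [← Real.sin_pi_sub] at h2; exact h2.trans (Real.sin_le (by linarith))
  set x := |α + β - Real.pi| with hx
  have hx0 : 0 ≤ x := abs_nonneg _
  have hxle : x ≤ Real.pi - 2 * δ := abs_le.2 ⟨by linarith, by linarith⟩
  have hsin : |Real.sin (α + β)| = Real.sin x := by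
    rw [← abs_of_nonneg (Real.sin_nonneg_of_nonneg_of_le_pi hx0 (by linarith)), hx]
    rcases abs_cases (α + β - Real.pi) with ⟨h, _⟩ | ⟨h, _⟩ <;> rw [h]
    · rw [Real.sin_sub_pi, abs_neg]
    · rw [neg_sub, Real.sin_pi_sub]
  have hpi : 3 / 5 ≤ 2 / Real.pi := by
    rw [le_div_iff₀ Real.pi_pos]
    have := Real.pi_lt_d2
    linarith
  by_contra! hcon
  rw [hsin] at h
  rcases le_total x (Real.pi / 2) with hle | hle
  · have := Real.mul_le_sin hx0 hle
    nlinarith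
  · have := Real.mul_le_sin (x := Real.pi - x) (by linarith) (by linarith)
    rw [Real.sin_pi_sub] at this
    nlinarith

/-- A direction strictly inside the cone of a triangle at `z` stays in the triangle for a while. -/
theorem exists_add_smul_mem_hull {z a b w : Plane} (hD : 0 < cross (a - z) (b - z))
    (h1 : 0 < cross (a - z) w) (h2 : 0 < cross w (b - z)) :
    ∃ ε > (0 : ℝ), ∀ τ : ℝ, 0 < τ → τ ≤ ε → z + τ • w ∈ hull {z, a, b} := by
  set D := cross (a - z) (b - z) with hDdef
  have hsum : 0 < cross w (b - z) / D + cross (a - z) w / D := by positivity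
  refine ⟨(cross w (b - z) / D + cross (a - z) w / D)⁻¹, by positivity, fun τ hτ hτ' => ?_⟩
  refine mem_hull_triple.2 ⟨τ * (cross w (b - z) / D), τ * (cross (a - z) w / D), by positivity,
    by positivity, ?_, ?_⟩
  · rw [← mul_add]
    calc _ ≤ _ := mul_le_mul_of_nonneg_right hτ' hsum.le
      _ = 1 := inv_mul_cancel₀ hsum.ne'
  · have hw : w = (cross w (b - z) / D) • (a - z) + (cross (a - z) w / D) • (b - z) := by
      ext i
      simp only [PiLp.add_apply, PiLp.smul_apply, smul_eq_mul]
      field_simp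
      fin_cases i
      · simp only [hDdef, cross, PiLp.sub_apply, Fin.zero_eta]; ring
      · simp only [hDdef, cross, PiLp.sub_apply, Fin.mk_one]; ring
    conv_lhs => rw [hw]
    rw [smul_add, smul_smul, smul_smul, add_assoc]

namespace Triangulation

variable {Ω : Domain} {T : Triangulation Ω}

theorem diam_div_inDiam_le {K : Finset Plane} (hK : K ∈ T.triangles) :
    Metric.diam (hull K) / inDiam K ≤ T.shapeRegularity :=
  le_ciSup (f := fun K : T.triangles => Metric.diam (hull K.1) / inDiam K.1)
    (Set.finite_range _).bddAbove ⟨K, hK⟩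

/-- The cones at `z` of two distinct triangles of the mesh have no common interior direction. -/
theorem not_cross_pos_of_ne {z a b a' b' w : Plane} (hK : {z, a, b} ∈ T.triangles)
    (hK' : {z, a', b'} ∈ T.triangles) (hne : ({z, a, b} : Finset Plane) ≠ {z, a', b'})
    (hD : 0 < cross (a - z) (b - z)) (hD' : 0 < cross (a' - z) (b' - z))
    (h1 : 0 < cross (a - z) w) (h2 : 0 < cross w (b - z))
    (h1' : 0 < cross (a' - z) w) (h2' : 0 < cross w (b' - z)) : False := by
  obtain ⟨ε, hε, hmem⟩ := exists_add_smul_mem_hull hD h1 h2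
  obtain ⟨ε', hε', hmem'⟩ := exists_add_smul_mem_hull hD' h1' h2'
  have hτ : 0 < min ε ε' := lt_min hε hε'
  have hx : z + min ε ε' • w ∈ hull ({z, a, b} ∩ {z, a', b'} : Finset Plane) := by
    rw [← T.conforming _ hK _ hK']
    exact ⟨hmem _ hτ (min_le_left _ _), hmem' _ hτ (min_le_right _ _)⟩
  obtain ⟨e, he, he'⟩ : ∃ e ∈ ({z, a, b} : Finset Plane), e ∉ ({z, a', b'} : Finset Plane) := by
    by_contra! hsub
    exact hne (Finset.eq_of_subset_of_card_le hsub (by rw [T.card_eq _ hK, T.card_eq _ hK']))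
  have hsub : ∀ c : Plane, ({z, a, b} ∩ {z, a', b'} : Finset Plane) ⊆ {z, c} →
      ∃ t : ℝ, min ε ε' • w = t • (c - z) := by
    intro c hc
    have := convexHull_mono (𝕜 := ℝ) (Finset.coe_subset.2 hc) hx
    rw [Finset.coe_pair, convexHull_pair, segment_eq_image'] at this
    obtain ⟨t, -, ht⟩ := this
    exact ⟨t, (add_left_cancel ht).symm⟩
  have hcases : e = a ∨ e = b := by
    simp only [Finset.mem_insert, Finset.mem_singleton, not_or] at he he'
    tauto
  rcases hcases with rfl | rfl
  · obtain ⟨t, ht⟩ := hsub b (by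
      intro x hx
      obtain ⟨m1, m2⟩ := Finset.mem_inter.1 hx
      simp only [Finset.mem_insert, Finset.mem_singleton] at m1 ⊢
      rcases m1 with m1 | m1 | m1
      · exact Or.inl m1
      · exact absurd (m1 ▸ m2) he'
      · exact Or.inr m1)
    have h := congrArg (fun x => cross x (b - z)) ht
    simp only [cross_smul_left, cross_self, mul_zero] at h
    exact (mul_pos hτ h2).ne' h
  · obtain ⟨t, ht⟩ := hsub a (by
      intro x hx
      obtain ⟨m1, m2⟩ := Finset.mem_inter.1 hx
      simp only [Finset.mem_insert, Finset.mem_singleton] at m1 ⊢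
      rcases m1 with m1 | m1 | m1
      · exact Or.inl m1
      · exact Or.inr m1
      · exact absurd (m1 ▸ m2) he')
    have h := congrArg (fun x => cross (a - z) x) ht
    simp only [cross_smul_right, cross_self, mul_zero] at h
    exact (mul_pos hτ h1).ne' h

namespace Numbering

variable (σ : T.Numbering)

theorem angle_eq (z : Plane) (ℓ : ℕ) :
    σ.angle z ℓ = InnerProductGeometry.angle (σ.pt z ℓ - z) (σ.pt z (ℓ + 1) - z) := rfl

/-- Shape regularity bounds the sines of all angles of the mesh from below. -/
theorem le_sin_angle {γ δ : ℝ} (hγ : T.shapeRegularity ≤ γ) (hδ : 0 ≤ δ) (hδγ : δ * γ ≤ 1)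
    {z : Plane} (hz : z ∈ T.vertices) {ℓ : ℕ} (hℓ : ℓ < T.N z) :
    δ ≤ Real.sin (σ.angle z ℓ) := by
  have hccw := σ.ccw z hz ℓ hℓ
  have hK := σ.tri_mem hz hℓ
  obtain ⟨hpos, hle⟩ := inDiam_pos_and_mul_norm_le hccw
    ((σ.interior_inter_nonempty hK).mono Set.inter_subset_left)
  have hshape := (T.diam_div_inDiam_le hK).trans hγ
  rw [tri, div_le_iff₀ hpos] at hshape
  have hv : ‖σ.pt z (ℓ + 1) - z‖ ≤ Metric.diam (hull {z, σ.pt z ℓ, σ.pt z (ℓ + 1)}) := by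
    rw [← dist_eq_norm]
    exact Metric.dist_le_diam_of_mem (isCompact_hull _).isBounded
      (subset_convexHull ℝ _ (by simp)) (subset_convexHull ℝ _ (by simp))
  have hs := sin_angle_mul_norm hccw
  rw [← angle_eq] at hs
  have hu0 : 0 < ‖σ.pt z ℓ - z‖ := by
    refine norm_pos_iff.2 fun h0 => ?_
    rw [h0] at hccw
    simp [cross] at hccw
  have hv0 : 0 < ‖σ.pt z (ℓ + 1) - z‖ := by
    refine norm_pos_iff.2 fun h0 => ?_
    rw [h0] at hccw
    simp [cross] at hccw
  refine le_of_mul_le_mul_right (a := ‖σ.pt z ℓ - z‖ * ‖σ.pt z (ℓ + 1) - z‖) ?_ (by positivity)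
  rw [hs]
  refine le_trans ?_ hle
  set I := inDiam {z, σ.pt z ℓ, σ.pt z (ℓ + 1)}
  have h1 : δ * ‖σ.pt z (ℓ + 1) - z‖ ≤ I := by
    calc _ ≤ δ * (γ * I) := mul_le_mul_of_nonneg_left (hv.trans hshape) hδ
      _ = (δ * γ) * I := by ring
      _ ≤ 1 * I := mul_le_mul_of_nonneg_right hδγ hpos.le
      _ = I := one_mul I
  nlinarith

theorem abs_sin_le_Theta {z : Plane} {ℓ : ℕ} (hℓ : ℓ + 1 < T.N z) :
    |Real.sin (σ.angle z ℓ + σ.angle z (ℓ + 1))| ≤ σ.Theta z := by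
  unfold Theta
  split_ifs with h1 h2
  · have := le_ciSup (f := fun i : Fin (T.N z) =>
      |Real.sin (σ.angle z i + σ.angle z ((i + 1) % T.N z))|) (Set.finite_range _).bddAbove
      ⟨ℓ, by omega⟩
    simpa only [Nat.mod_eq_of_lt hℓ] using this
  · omega
  · exact le_ciSup (f := fun i : Fin (T.N z - 1) =>
      |Real.sin (σ.angle z i + σ.angle z (i + 1))|) (Set.finite_range _).bddAbove ⟨ℓ, by omega⟩

/-- At a critical vertex, any two consecutive angles add up to nearly `π`. So four consecutive
triangles nearly fill the full angle, and a fifth one would overlap the first. -/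
theorem N_le_four {γ δ η : ℝ} (hγ : T.shapeRegularity ≤ γ) (hδ : 0 < δ) (hδγ : δ * γ ≤ 1)
    (hη : η < δ / 5) {z : Plane} (hz : z ∈ σ.crit η) : T.N z ≤ 4 := by
  obtain ⟨hz, hΘ⟩ := Finset.mem_filter.1 hz
  by_contra! hN
  have hsin : ∀ ℓ < 5, δ ≤ Real.sin (σ.angle z ℓ) := fun ℓ hℓ =>
    σ.le_sin_angle hγ hδ.le hδγ hz (by omega)
  have hnn : ∀ ℓ, 0 ≤ σ.angle z ℓ := fun ℓ => EuclideanGeometry.angle_nonneg _ _ _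
  have hpi : ∀ ℓ, σ.angle z ℓ ≤ Real.pi := fun ℓ => EuclideanGeometry.angle_le_pi _ _ _
  have hpair : ∀ ℓ < 4, |σ.angle z ℓ + σ.angle z (ℓ + 1) - Real.pi| < δ / 3 := fun ℓ hℓ =>
    abs_add_sub_pi_lt hδ (hnn _) (hpi _) (hnn _) (hpi _) (hsin _ (by omega)) (hsin _ (by omega))
      (((σ.abs_sin_le_Theta (by omega)).trans hΘ).trans_lt hη)
  have hccw : ∀ ℓ < 5, 0 < cross (σ.pt z ℓ - z) (σ.pt z (ℓ + 1) - z) := fun ℓ hℓ =>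
    σ.ccw z hz ℓ (by omega)
  obtain ⟨a, ha⟩ := exists_eq_norm_smul_dir (σ.pt z 0 - z)
  have h1 := eq_norm_smul_dir_add_angle ha (hccw 0 (by norm_num))
  have h2 := eq_norm_smul_dir_add_angle h1 (hccw 1 (by norm_num))
  have h3 := eq_norm_smul_dir_add_angle h2 (hccw 2 (by norm_num))
  have h4 := eq_norm_smul_dir_add_angle h3 (hccw 3 (by norm_num))
  have h5 := eq_norm_smul_dir_add_angle h4 (hccw 4 (by norm_num))
  simp only [← angle_eq, zero_add, Nat.reduceAdd] at h1 h2 h3 h4 h5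
  obtain ⟨p1, p2⟩ := abs_lt.1 (hpair 0 (by norm_num))
  obtain ⟨p3, p4⟩ := abs_lt.1 (hpair 2 (by norm_num))
  simp only [zero_add, Nat.reduceAdd] at p1 p2 p3 p4
  set θ := σ.angle z
  have hθ : ∀ ℓ < 5, δ ≤ θ ℓ := fun ℓ hℓ => (hsin ℓ hℓ).trans (Real.sin_le (hnn ℓ))
  have q0 := hθ 0 (by norm_num)
  have q4 := hθ 4 (by norm_num)
  set s := θ 0 + θ 1 + θ 2 + θ 3 - 2 * Real.pi with hs
  -- `β` is a direction inside the cones of the first and of the fifth triangle, modulo `2π`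
  obtain ⟨β, hβ1, hβ2⟩ : ∃ β, max s 0 < β ∧ β < min (s + θ 4) (θ 0) :=
    exists_between (max_lt (lt_min (by linarith) (by linarith))
      (lt_min (by linarith) (by linarith)))
  obtain ⟨b1, b2⟩ := max_lt_iff.1 hβ1
  obtain ⟨b3, b4⟩ := lt_min_iff.1 hβ2
  have hne : ∀ ℓ < 5, σ.pt z ℓ - z ≠ 0 ∧ σ.pt z (ℓ + 1) - z ≠ 0 := by
    intro ℓ hℓ
    have := hccw ℓ hℓ
    constructor <;> intro h0 <;> rw [h0] at this <;> simp [cross] at this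
  have hper : dir (a + β + 2 * Real.pi) = dir (a + β) := by simp [dir]
  have hpi0 := hpi 0
  have hpi4 := hpi 4
  refine T.not_cross_pos_of_ne (w := dir (a + β)) (σ.tri_mem hz (ℓ := 0) (by omega))
    (σ.tri_mem hz (ℓ := 4) (by omega)) ?_ (hccw 0 (by norm_num)) (hccw 4 (by norm_num)) ?_ ?_ ?_ ?_
  · intro h
    have := σ.tri_injOn hz (Finset.mem_coe.2 (Finset.mem_range.2 (show 0 < T.N z by omega)))
      (Finset.mem_coe.2 (Finset.mem_range.2 (show 4 < T.N z by omega))) h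
    omega
  · rw [ha, cross_smul_left, cross_dir]
    exact mul_pos (norm_pos_iff.2 (hne 0 (by norm_num)).1)
      (Real.sin_pos_of_pos_of_lt_pi (by linarith) (by linarith))
  · rw [zero_add, h1, cross_smul_right, cross_dir]
    exact mul_pos (norm_pos_iff.2 (hne 0 (by norm_num)).2)
      (Real.sin_pos_of_pos_of_lt_pi (by linarith) (by linarith))
  · rw [← hper, h4, cross_smul_left, cross_dir]
    exact mul_pos (norm_pos_iff.2 (hne 4 (by norm_num)).1)
      (Real.sin_pos_of_pos_of_lt_pi (by linarith) (by linarith))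
  · rw [← hper, h5, cross_smul_right, cross_dir]
    exact mul_pos (norm_pos_iff.2 (hne 4 (by norm_num)).2)
      (Real.sin_pos_of_pos_of_lt_pi (by linarith) (by linarith))

/-- Critical vertices that are not super-critical have an even number of triangles. -/
theorem even_N_of_notMem_superCrit {γ δ η : ℝ} (hγ : T.shapeRegularity ≤ γ) (hδ : 0 < δ)
    (hδγ : δ * γ ≤ 1) (hη : η < δ / 5) {z : Plane} (hz : z ∈ σ.crit η)
    (hzS : z ∉ σ.superCrit η) : Even (T.N z) := by
  have h4 := σ.N_le_four hγ hδ hδγ hη hz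
  have h13 : ¬ (T.N z = 1 ∨ T.N z = 3) := fun h => hzS (Finset.mem_filter.2 ⟨hz, h⟩)
  rw [Nat.even_iff]
  omega

end Numbering

end Triangulation

/-! ### The modified pressure space and its complement -/

/-- Let `M` be the orthogonal complement of finitely many independent vectors `c i`. If a subspace
`U` meets `M` trivially and contains, for every `i`, a vector `g i` that is modulo `M` a nonzero
multiple of `c i`, then the `g i` form a basis of `U`. -/
theorem exists_basis_of_sub_smul_mem {H ι : Type*} [NormedAddCommGroup H] [InnerProductSpace ℝ H]
    [Fintype ι] {U : Submodule ℝ H} {c g : ι → H} (hc : LinearIndependent ℝ c)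
    (hgU : ∀ i, g i ∈ U)
    (hg : ∀ i, ∃ ρ : ℝ, ρ ≠ 0 ∧ g i - ρ • c i ∈ (Submodule.span ℝ (Set.range c))ᗮ)
    (hU : ∀ u ∈ U, u ∈ (Submodule.span ℝ (Set.range c))ᗮ → u = 0) :
    ∃ B : Module.Basis ι ℝ U, ∀ i, (B i : H) = g i := by
  choose ρ hρ hm using hg
  set S := Submodule.span ℝ (Set.range c)
  have hgi : ∀ i, g i = ρ i • c i + (g i - ρ i • c i) := fun i => by abel
  have hli : LinearIndependent ℝ fun i => (⟨g i, hgU i⟩ : U) := by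
    rw [Fintype.linearIndependent_iff]
    intro a ha
    have h0 : ∑ i, a i • g i = 0 := by simpa using congrArg (Subtype.val : U → H) ha
    have h1 : ∑ i, (a i * ρ i) • c i = -∑ i, a i • (g i - ρ i • c i) := by
      rw [eq_neg_iff_add_eq_zero, ← Finset.sum_add_distrib, ← h0]
      refine Finset.sum_congr rfl fun i _ => ?_
      module
    have h2 : ∑ i, (a i * ρ i) • c i ∈ S := Submodule.sum_mem _ fun i _ =>
      Submodule.smul_mem _ _ (Submodule.subset_span ⟨i, rfl⟩)
    have h3 : ∑ i, (a i * ρ i) • c i ∈ Sᗮ := by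
      rw [h1]
      exact Submodule.neg_mem _ (Submodule.sum_mem _ fun i _ =>
        Submodule.smul_mem _ _ (hm i))
    have h4 : ∑ i, (a i * ρ i) • c i = 0 := inner_self_eq_zero.1 (h3 _ h2)
    intro i
    exact (mul_eq_zero.1 (Fintype.linearIndependent_iff.1 hc _ h4 i)).resolve_right (hρ i)
  have hspan : ⊤ ≤ Submodule.span ℝ (Set.range fun i => (⟨g i, hgU i⟩ : U)) := by
    rintro ⟨u, hu⟩ -
    have : FiniteDimensional ℝ S := FiniteDimensional.span_of_finite ℝ (Set.finite_range c)
    obtain ⟨β, hβ⟩ := (Submodule.mem_span_range_iff_exists_fun ℝ).1 (S.starProjection_apply_mem u)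
    have h1 : u - ∑ i, (β i / ρ i) • g i ∈ Sᗮ := by
      have h2 : u - ∑ i, (β i / ρ i) • g i
          = (u - S.starProjection u) - ∑ i, (β i / ρ i) • (g i - ρ i • c i) := by
        rw [← hβ, sub_sub, ← Finset.sum_add_distrib]
        congr 1
        refine Finset.sum_congr rfl fun i _ => ?_
        rw [smul_sub, smul_smul, div_mul_cancel₀ _ (hρ i)]
        abel
      rw [h2]
      exact Submodule.sub_mem _ (S.sub_starProjection_mem_orthogonal u)
        (Submodule.sum_mem _ fun i _ => Submodule.smul_mem _ _ (hm i))
    have h3 := hU _ (Submodule.sub_mem _ hu (Submodule.sum_mem _ fun i _ =>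
      Submodule.smul_mem _ _ (hgU i))) h1
    rw [Submodule.mem_span_range_iff_exists_fun]
    refine ⟨fun i => β i / ρ i, Subtype.ext ?_⟩
    simpa using (sub_eq_zero.1 h3).symm
  refine ⟨Module.Basis.mk hli hspan, fun i => ?_⟩
  rw [Module.Basis.mk_apply]

namespace Triangulation

variable {Ω : Domain} {T : Triangulation Ω}

/-- `ℙ_{n,0}(𝒯)`: the piecewise polynomials with vanishing integral. -/
def brokenPolyZero (T : Triangulation Ω) (n : ℕ) : Submodule ℝ (L2 Ω) :=
  T.brokenPoly n ⊓ (Submodule.span ℝ {constL2 Ω 1})ᗮ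

theorem mem_brokenPolyZero {n : ℕ} {q : L2 Ω} :
    q ∈ T.brokenPolyZero n ↔ q ∈ T.brokenPoly n ∧ inner ℝ (constL2 Ω 1) q = 0 := by
  rw [brokenPolyZero, Submodule.mem_inf, Submodule.mem_orthogonal_singleton_iff_inner_right]

namespace Numbering

variable (σ : T.Numbering)

theorem mem_vertices_of_mem_crit {σ : T.Numbering} {η : ℝ} {z : Plane} (hz : z ∈ σ.crit η) :
    z ∈ T.vertices := (Finset.mem_filter.1 hz).1

theorem mem_crit_of_mem_superCrit {σ : T.Numbering} {η : ℝ} {z : Plane}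
    (hz : z ∈ σ.superCrit η) : z ∈ σ.crit η := (Finset.mem_filter.1 hz).1

theorem mvz_b_mem (n : ℕ) {z : Plane} (hz : z ∈ T.vertices) :
    mvz (σ.b n z) ∈ T.brokenPolyZero n :=
  mem_brokenPolyZero.2 ⟨Submodule.sub_mem _ (σ.b_mem_brokenPoly n hz)
    (T.constL2_mem_brokenPoly n _), inner_one_mvz _⟩

theorem inner_mvz {p q : L2 Ω} (hq : inner ℝ (constL2 Ω 1) q = 0) :
    inner ℝ (mvz p) q = inner ℝ p q := by
  rw [mvz_eq, inner_sub_left, real_inner_smul_left, hq, mul_zero, sub_zero]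

/-- `M_{η,n}(𝒯)` is the orthogonal complement of the functions `(b_{n,z})_mvz`. -/
theorem mem_pressure_iff {η : ℝ} {n : ℕ} {q : L2 Ω} :
    q ∈ σ.pressure η n ↔
      q ∈ T.brokenPolyZero n ∧ ∀ z ∈ σ.crit η, inner ℝ (mvz (σ.b n z)) q = 0 := by
  rw [mem_brokenPolyZero, inner_one, and_assoc]
  refine and_congr_right fun hq => and_congr_right fun h0 => forall₂_congr fun z hz => ?_
  have hB : ((n + 2).choose 2 : ℝ) ≠ 0 := Nat.cast_ne_zero.2 (Nat.choose_pos (by omega)).ne'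
  rw [inner_mvz (by rw [inner_one, h0]), σ.inner_b n (mem_vertices_of_mem_crit hz) hq]
  simp [hB]

theorem inner_b_of_mem_pressure {η : ℝ} {n : ℕ} {q : L2 Ω} (hq : q ∈ σ.pressure η n) {z : Plane}
    (hz : z ∈ σ.crit η) : inner ℝ (σ.b n z) q = 0 := by
  obtain ⟨h0, h⟩ := σ.mem_pressure_iff.1 hq
  rw [← inner_mvz (mem_brokenPolyZero.1 h0).2, h z hz]

theorem mem_pressure_iff_mem_orthogonal {η : ℝ} {n : ℕ} {q : L2 Ω} :
    q ∈ σ.pressure η n ↔ q ∈ T.brokenPolyZero n ⊓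
      (Submodule.span ℝ (Set.range fun z : σ.crit η => mvz (σ.b n z)))ᗮ := by
  rw [mem_pressure_iff, Submodule.mem_inf]
  refine and_congr_right fun _ => ⟨fun h => ?_, fun h z hz => ?_⟩
  · rw [← Submodule.span_singleton_le_iff_mem, ← Submodule.isOrtho_iff_le, Submodule.isOrtho_comm,
      Submodule.isOrtho_span]
    rintro _ ⟨z, rfl⟩ _ rfl
    exact h z z.2
  · exact h _ (Submodule.subset_span ⟨⟨z, hz⟩, rfl⟩)

theorem linearIndependent_mvz_b {n : ℕ} (hn : 2 ≤ n) (η : ℝ) :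
    LinearIndependent ℝ fun z : σ.crit η => mvz (σ.b n z) := by
  rw [Fintype.linearIndependent_iff]
  intro a ha z
  let α : Plane → ℝ := fun z => if h : z ∈ σ.crit η then a ⟨z, h⟩ else 0
  have hα : ∀ z : σ.crit η, α z = a z := fun z => dif_pos z.2
  have h1 : ∑ z ∈ σ.crit η, α z • σ.b n z
      = constL2 Ω (∑ z ∈ σ.crit η, α z * mean (σ.b n z)) := by
    rw [constL2_eq_smul, Finset.sum_smul, ← sub_eq_zero, ← Finset.sum_sub_distrib,
      ← Finset.sum_coe_sort, ← ha]
    refine Finset.sum_congr rfl fun z _ => ?_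
    rw [hα, mvz_eq, smul_sub, smul_smul]
  rw [← hα]
  exact σ.coeff_eq_zero_of_sum_b_eq_const hn (fun z hz => mem_vertices_of_mem_crit hz) α _ h1 z z.2

theorem b_ne_zero {n : ℕ} (hn : 2 ≤ n) {z : Plane} (hz : z ∈ T.vertices) : σ.b n z ≠ 0 := by
  intro h
  refine one_ne_zero (σ.coeff_eq_zero_of_sum_b_eq_const hn (C := {z})
    (Finset.singleton_subset_iff.2 hz) (fun _ => 1) 0 ?_ z (Finset.mem_singleton_self z))
  rw [Finset.sum_singleton, h, smul_zero, constL2_eq_smul, zero_smul]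

/-- The critical function of a Robinson vertex is orthogonal to those of all other critical
vertices, as their patches are disjoint. -/
theorem IsRobinson.inner_b_eq_zero {σ : T.Numbering} {η : ℝ} {K' : Plane → Finset Plane}
    {y : Plane} (hy : σ.IsRobinson η K' y) (hyv : y ∈ T.vertices) (n : ℕ) {z : Plane}
    (hz : z ∈ σ.crit η) (hne : z ≠ y) : inner ℝ (σ.b n y) (σ.b n z) = 0 := by
  refine σ.inner_b_eq_zero n hyv (mem_vertices_of_mem_crit hz) fun K hK hK' => hne ?_
  have : z ∈ (⋃ K ∈ σ.extPatch K' y, hull K) ∩ (σ.crit η : Set Plane) :=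
    ⟨Set.mem_biUnion (show K ∈ σ.extPatch K' y from Finset.mem_insert_of_mem hK)
      (mem_patch.1 hK').2, hz⟩
  rw [hy.2] at this
  exact this

theorem b_mem_modPressurePerp {η : ℝ} {n : ℕ} {f : Plane → T.brokenPoly n →ₗ[ℝ] ℝ} {z : Plane}
    (hz : z ∈ σ.crit η) (he : Even (T.N z))
    (h0 : ∀ y ∈ σ.superCrit η, inner ℝ (σ.b n z) (σ.b n y) = 0) :
    σ.b n z ∈ σ.modPressurePerp η n f := by
  have hzv := mem_vertices_of_mem_crit hz
  have h1 := σ.inner_b_one_of_even n hzv he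
  refine ⟨σ.b_mem_brokenPoly n hzv, by rw [← inner_one, real_inner_comm, h1], ?_⟩
  rintro p ⟨q, hq, rfl⟩
  rw [inner_add_right, σ.inner_b_of_mem_pressure hq hz, inner_sum, zero_add]
  refine Finset.sum_eq_zero fun y hy => ?_
  rw [real_inner_smul_right, mvz_eq, inner_sub_right, real_inner_smul_right, h0 y hy, h1]
  ring

theorem varphi_sub_smul_mem_pressure {η : ℝ} {n : ℕ} {φ : Plane → L2 Ω}
    (hφ : ∀ z ∈ σ.superCrit η, φ z ∈ σ.pressure η n) {z : Plane} (hz : z ∈ σ.superCrit η) :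
    σ.varphi η n φ z - (-(1 / ‖σ.b n z‖ ^ 2)) • mvz (σ.b n z) ∈ σ.pressure η n := by
  rw [mem_pressure_iff_mem_orthogonal]
  have hφ' := fun y hy => σ.mem_pressure_iff_mem_orthogonal.1 (hφ y hy)
  have h1 : σ.varphi η n φ z - (-(1 / ‖σ.b n z‖ ^ 2)) • mvz (σ.b n z)
      = φ z - (1 / ‖σ.b n z‖ ^ 2) • ∑ y ∈ σ.superCrit η,
        (inner ℝ (constL2 Ω (mean (σ.b n z))) (σ.b n y) : ℝ) • φ y := by
    rw [varphi]
    module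
  rw [h1]
  exact Submodule.sub_mem _ (hφ' z hz) (Submodule.smul_mem _ _ (Submodule.sum_mem _ fun y hy =>
    Submodule.smul_mem _ _ (hφ' y hy)))

/-- Orthogonality of `φ_z - ‖b_z‖⁻² ((b_z)_mvz + ∑_y (mean b_z, b_y) φ_y)` to
`q + ∑_y f_y(q) (b_y)_mvz`: the pairings of `φ_z` and `(b_z)_mvz` with the sum give `f_z(q)` and
`f_z(q) ‖b_z‖² - ∑_y f_y(q) (mean b_z, b_y)`, and the last sum of `varphi` removes the error. -/
theorem varphi_mem_modPressurePerp {η : ℝ} {n : ℕ} (hn : 2 ≤ n)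
    {f : Plane → T.brokenPoly n →ₗ[ℝ] ℝ} {φ : Plane → L2 Ω}
    (hφ : ∀ z ∈ σ.superCrit η, σ.IsRieszRep η n (f z) (φ z)) {z : Plane}
    (hz : z ∈ σ.superCrit η)
    (h0 : ∀ y ∈ σ.superCrit η, y ≠ z → inner ℝ (σ.b n z) (σ.b n y) = 0) :
    σ.varphi η n φ z ∈ σ.modPressurePerp η n f := by
  have hzc := mem_crit_of_mem_superCrit hz
  have hzv := mem_vertices_of_mem_crit hzc
  have hV : σ.varphi η n φ z ∈ T.brokenPolyZero n := by
    have h1 := (σ.mem_pressure_iff.1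
      (σ.varphi_sub_smul_mem_pressure (fun z hz => (hφ z hz).1) hz)).1
    have h2 := Submodule.add_mem _ h1
      (Submodule.smul_mem _ (-(1 / ‖σ.b n z‖ ^ 2)) (σ.mvz_b_mem n hzv))
    rwa [sub_add_cancel] at h2
  obtain ⟨hVb, hV0⟩ := mem_brokenPolyZero.1 hV
  refine ⟨hVb, by rw [← inner_one, hV0], ?_⟩
  rintro p ⟨q, hq, rfl⟩
  have hφp : ∀ y ∈ σ.superCrit η, inner ℝ (φ y)
      ((q : L2 Ω) + ∑ w ∈ σ.superCrit η, f w q • mvz (σ.b n w)) = f y q := by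
    intro y hy
    rw [inner_add_right, (hφ y hy).2 q hq, inner_sum, Finset.sum_eq_zero, add_zero]
    intro w hw
    rw [real_inner_smul_right, real_inner_comm,
      (σ.mem_pressure_iff.1 (hφ y hy).1).2 w (mem_crit_of_mem_superCrit hw), mul_zero]
  have hb : inner ℝ (mvz (σ.b n z))
      ((q : L2 Ω) + ∑ w ∈ σ.superCrit η, f w q • mvz (σ.b n w))
      = f z q * ‖σ.b n z‖ ^ 2 - ∑ w ∈ σ.superCrit η,
        (inner ℝ (constL2 Ω (mean (σ.b n z))) (σ.b n w) : ℝ) * f w q := by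
    have h1 : ∀ w ∈ σ.superCrit η, inner ℝ (mvz (σ.b n z)) (f w q • mvz (σ.b n w))
        = (if w = z then f w q * ‖σ.b n z‖ ^ 2 else 0)
          - inner ℝ (constL2 Ω (mean (σ.b n z))) (σ.b n w) * f w q := by
      intro w hw
      have h2 : inner ℝ (mvz (σ.b n z)) (mvz (σ.b n w)) = inner ℝ (mvz (σ.b n z)) (σ.b n w) := by
        rw [mvz_eq (σ.b n w), inner_sub_right, real_inner_smul_right,
          real_inner_comm (constL2 Ω 1), inner_one_mvz, mul_zero, sub_zero]
      rw [real_inner_smul_right, h2, mvz, inner_sub_left]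
      split_ifs with hwz
      · rw [hwz, real_inner_self_eq_norm_sq]
        ring
      · rw [h0 w hw hwz]
        ring
    rw [inner_add_right, (σ.mem_pressure_iff.1 hq).2 z hzc, zero_add, inner_sum,
      Finset.sum_congr rfl h1, Finset.sum_sub_distrib, Finset.sum_ite_eq', if_pos hz]
  have hb0 : ‖σ.b n z‖ ^ 2 ≠ 0 := pow_ne_zero _ (norm_ne_zero_iff.2 (σ.b_ne_zero hn hzv))
  have hsum : inner ℝ (∑ y ∈ σ.superCrit η,
      (inner ℝ (constL2 Ω (mean (σ.b n z))) (σ.b n y) : ℝ) • φ y)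
      ((q : L2 Ω) + ∑ w ∈ σ.superCrit η, f w q • mvz (σ.b n w))
      = ∑ w ∈ σ.superCrit η, inner ℝ (constL2 Ω (mean (σ.b n z))) (σ.b n w) * f w q := by
    rw [sum_inner]
    refine Finset.sum_congr rfl fun y hy => ?_
    rw [real_inner_smul_left, hφp y hy]
  rw [varphi, inner_sub_left, hφp z hz, real_inner_smul_left, inner_add_left, hb, hsum,
    sub_add_cancel, mul_comm (f z q), ← mul_assoc, one_div_mul_cancel hb0, one_mul, sub_self]

theorem modPressurePerp_le {η : ℝ} {n : ℕ} {f : Plane → T.brokenPoly n →ₗ[ℝ] ℝ} :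
    σ.modPressurePerp η n f ≤ T.brokenPolyZero n := fun _ hq =>
  mem_brokenPolyZero.2 ⟨hq.1, by rw [inner_one, hq.2.1]⟩

/-- `M_{η,n}(𝒯)` and `M^mod_{η,n}(𝒯)^⊥` meet trivially: `u` in the intersection is orthogonal to
`u + ∑_y f_y(u) (b_y)_mvz` and to all `(b_y)_mvz`. -/
theorem eq_zero_of_mem_modPressurePerp {η : ℝ} {n : ℕ} {f : Plane → T.brokenPoly n →ₗ[ℝ] ℝ}
    {u : L2 Ω} (hu : u ∈ σ.modPressurePerp η n f) (hu' : u ∈ σ.pressure η n) : u = 0 := by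
  have h := hu.2.2 _ ⟨⟨u, hu.1⟩, hu', rfl⟩
  rw [inner_add_right, inner_sum, Finset.sum_eq_zero, add_zero] at h
  · exact inner_self_eq_zero.1 h
  · intro y hy
    rw [real_inner_smul_right, real_inner_comm,
      (σ.mem_pressure_iff.1 hu').2 y (mem_crit_of_mem_superCrit hy), mul_zero]

end Numbering

end Triangulation

end PressureWired

end

open PressureWired
theorem mainTheorem10 (Ω : Domain) (γ : ℝ) :
    ∃ η₀ : ℝ, 0 < η₀ ∧
      ∀ (T : Triangulation Ω) (σ : T.Numbering), T.shapeRegularity ≤ γ →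
      ∀ η : ℝ, 0 ≤ η → η < η₀ →
      ∀ K' : Plane → Finset Plane,
        (∀ z ∈ σ.superCrit η, σ.IsExtension z (K' z)) →
        (∀ z ∈ σ.superCrit η, σ.IsRobinson η K' z) →
      ∀ k : ℕ, 4 ≤ k →
      ∀ f : Plane → T.brokenPoly (k - 1) →ₗ[ℝ] ℝ,
      ∀ φ : Plane → L2 Ω,
        (∀ z ∈ σ.superCrit η, σ.IsRieszRep η (k - 1) (f z) (φ z)) →
      ∃ B : Module.Basis (σ.crit η) ℝ (σ.modPressurePerp η (k - 1) f),
        ∀ z : σ.crit η,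
          ((z : Plane) ∉ σ.superCrit η → (B z : L2 Ω) = σ.b (k - 1) z) ∧
          ((z : Plane) ∈ σ.superCrit η → (B z : L2 Ω) = σ.varphi η (k - 1) φ z) := by
  have hδ : 0 < 1 / (|γ| + 1) := by positivity
  have hδγ : 1 / (|γ| + 1) * γ ≤ 1 := by
    rw [one_div_mul_eq_div, div_le_one (by positivity)]
    exact (le_abs_self γ).trans (by linarith)
  -- `1 / (|γ| + 1)` is a lower bound for the sines of all angles of the mesh
  refine ⟨1 / (|γ| + 1) / 5, by positivity, ?_⟩
  intro T σ hγ η _ hη K' _ hR k hk f φ hφ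
  have hn : 2 ≤ k - 1 := by omega
  have hort : ∀ z ∈ σ.crit η, ∀ y ∈ σ.superCrit η, y ≠ z →
      inner ℝ (σ.b (k - 1) z) (σ.b (k - 1) y) = 0 := by
    intro z hz y hy hne
    rw [real_inner_comm]
    exact (hR y hy).inner_b_eq_zero (Triangulation.Numbering.mem_vertices_of_mem_crit
      (Triangulation.Numbering.mem_crit_of_mem_superCrit hy)) (k - 1) hz hne.symm
  let g : σ.crit η → L2 Ω := fun z =>
    if (z : Plane) ∈ σ.superCrit η then σ.varphi η (k - 1) φ z else σ.b (k - 1) z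
  have hmean : ∀ z : σ.crit η, (z : Plane) ∉ σ.superCrit η →
      mvz (σ.b (k - 1) z) = σ.b (k - 1) z := by
    intro z hz
    rw [mvz_eq, mean_eq, real_inner_comm, σ.inner_b_one_of_even (k - 1)
      (Triangulation.Numbering.mem_vertices_of_mem_crit z.2)
      (σ.even_N_of_notMem_superCrit hγ hδ hδγ hη z.2 hz), mul_zero, zero_smul, sub_zero]
  obtain ⟨B, hB⟩ := exists_basis_of_sub_smul_mem (g := g) (U := σ.modPressurePerp η (k - 1) f)
    (σ.linearIndependent_mvz_b hn η)
    (fun z => by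
      by_cases hz : (z : Plane) ∈ σ.superCrit η
      · rw [show g z = _ from if_pos hz]
        exact σ.varphi_mem_modPressurePerp hn hφ hz (hort z z.2)
      · rw [show g z = _ from if_neg hz]
        exact σ.b_mem_modPressurePerp z.2
          (σ.even_N_of_notMem_superCrit hγ hδ hδγ hη z.2 hz)
          fun y hy => hort z z.2 y hy fun h => hz (h ▸ hy))
    (fun z => by
      by_cases hz : (z : Plane) ∈ σ.superCrit η
      · refine ⟨-(1 / ‖σ.b (k - 1) z‖ ^ 2), ?_, ?_⟩
        · exact neg_ne_zero.2 (one_div_ne_zero (pow_ne_zero _ (norm_ne_zero_iff.2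
            (σ.b_ne_zero hn (Triangulation.Numbering.mem_vertices_of_mem_crit z.2)))))
        · rw [show g z = _ from if_pos hz]
          exact (Submodule.mem_inf.1 (σ.mem_pressure_iff_mem_orthogonal.1
            (σ.varphi_sub_smul_mem_pressure (fun z hz => (hφ z hz).1) hz))).2
      · refine ⟨1, one_ne_zero, ?_⟩
        rw [show g z = _ from if_neg hz, one_smul, hmean z hz, sub_self]
        exact Submodule.zero_mem _)
    (fun u hu hu' => σ.eq_zero_of_mem_modPressurePerp hu
      (σ.mem_pressure_iff_mem_orthogonal.2
        (Submodule.mem_inf.2 ⟨σ.modPressurePerp_le hu, hu'⟩)))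
  refine ⟨B, fun z => ⟨fun hz => ?_, fun hz => ?_⟩⟩
  · rw [hB]; exact if_neg hz
  · rw [hB]; exact if_pos hz
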